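/- For a finite simple graph $\Gamma$, let $Z(\Gamma)$ denote its zero forcing number: the minimum size of a set of initially blue vertices from which all vertices become blue by repeatedly applying the rule "a blue vertex with exactly one white neighbor turns that neighbor blue". Let $k\ge 2$. Let $H$ be the graph on $\{0,1,\dots,3k-2\}$ in which $i$ is adjacent to $k+i,k+i+1,\dots,2k+i-1$ modulo $3k-1$. Let $A=\{a_0,\dots,a_k\}$ be a clique and let $B=\{b_0,\dots,b_k\}$ and $C=\{c_1,\dots,c_{k-1}\}$ be cocliques. Let $G$ be the disjoint union of $H,A,B,C$ together with the following edges: 1. $a_i\sim b_j$ for $0\le i,j\le k$, $i\ne j$; 2. $c_i\sim j$ for $1\le i\le k-1$ and $j\in\{0,k,k+1,\dots,3k-2\}$; 3. $b_i\sim j$ for $0\le i\le k-1$ and $1\le j\le k-1$, and $b_k\sim j$ for $2k\le j\le 3k-2$; 4. $b_i\sim k+i-1$ for $1\le i\le k$, and $b_0\sim 0$. Let $X=V(A)\cup V(H)$, and let $G'$ be obtained from $G$ as follows: for every vertex $x\notin X$ with exactly $|X|/2$ neighbors in $X$, delete the edges from $x$ to these neighbors and join $x$ instead to the other $|X|/2$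 vertices of $X$. Then $G$ and $G'$ have $6k$ vertices. The set $X$ is a Godsil–McKay switching set of $G$, that is, $X$ induces a regular subgraph of $G$ and every vertex outside $X$ has $0$, $|X|/2$ or $|X|$ neighbors in $X$. Both $G$ and $G'$ are $2k$-regular. They have the same spectrum (with multiplicities) with respect to the adjacency matrix, and also with respect to the Laplacian, the signless Laplacian and the normalized Laplacian matrix. Moreover $Z(G)=4k-2$ and $Z(G')\le 4k-3$; in particular $Z(G)\ne Z(G')$. Consequently, for every $k\ge 2$ there is a pair of $2k$-regular cospectral graphs on $6k$ vertices with different zero forcing numbers. -/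

import Mathlib

namespace RegularCospectral

section General

variable {V : Type*}

/-- One application of the standard color change rule: `B` is the set of blue vertices, and some
blue vertex `u` whose only white neighbor is `v` forces `v` to become blue. -/
def ForceStep [DecidableEq V] (G : SimpleGraph V) (B B' : Finset V) : Prop :=
  ∃ u ∈ B, ∃ v, v ∉ B ∧ G.Adj u v ∧ (∀ w, G.Adj u w → w ∉ B → w = v) ∧ B' = insert v B

/-- `S` is a zero forcing set: starting with `S` blue, iterating the color change rule can turn
every vertex blue. -/
def IsZeroForcingSet [Fintype V] [DecidableEq V] (G : SimpleGraph V) (S : Finset V) : Prop :=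
  Relation.ReflTransGen (ForceStep G) S Finset.univ

/-- The zero forcing number `Z(G)`, the minimum cardinality of a zero forcing set. (The set of
cardinalities is nonempty, since the set of all vertices is zero forcing.) -/
noncomputable def zeroForcingNumber [Fintype V] [DecidableEq V] (G : SimpleGraph V) : ℕ :=
  sInf {n : ℕ | ∃ S : Finset V, IsZeroForcingSet G S ∧ S.card = n}

/-- The spectrum of a real square matrix as a multiset: its real eigenvalues, each repeated
according to its algebraic multiplicity. All matrices below are symmetric, so that these are all
of the eigenvalues. -/
noncomputable def eigenvalueMultiset [Fintype V] [DecidableEq V] (M : Matrix V V ℝ) :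
    Multiset ℝ :=
  M.charpoly.roots

/-- The signless Laplacian matrix `D + A`. -/
def signlessLapMatrix [Fintype V] [DecidableEq V] (G : SimpleGraph V) [DecidableRel G.Adj] :
    Matrix V V ℝ :=
  G.degMatrix ℝ + G.adjMatrix ℝ

/-- The normalized Laplacian matrix `D^(-1/2) * L * D^(-1/2)`, where `D^(-1/2)` has entry `0` at an
isolated vertex. -/
noncomputable def normalizedLapMatrix [Fintype V] [DecidableEq V] (G : SimpleGraph V)
    [DecidableRel G.Adj] : Matrix V V ℝ :=
  Matrix.diagonal (fun v => (Real.sqrt (G.degree v))⁻¹) * G.lapMatrix ℝ *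
    Matrix.diagonal (fun v => (Real.sqrt (G.degree v))⁻¹)

/-- The number of neighbors of `x` that lie in `X`. -/
def nbrCount (G : SimpleGraph V) [DecidableRel G.Adj] (X : Finset V) (x : V) : ℕ :=
  (X.filter (fun y => G.Adj x y)).card

/-- `X` is a Godsil–McKay switching set of `G`: it induces a regular subgraph, and every vertex
outside `X` has `0`, `|X| / 2` or `|X|` neighbors in `X`. -/
def IsSwitchingSet (G : SimpleGraph V) [DecidableRel G.Adj] (X : Finset V) : Prop :=
  (∃ d : ℕ, ∀ x ∈ X, nbrCount G X x = d) ∧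
    ∀ x, x ∉ X → nbrCount G X x = 0 ∨ 2 * nbrCount G X x = X.card ∨ nbrCount G X x = X.card

/-- The pair `x`, `y` is switched: `x` is outside `X`, exactly half of the vertices of `X` are
neighbors of `x`, and `y` is in `X`. -/
def Switched (G : SimpleGraph V) [DecidableRel G.Adj] (X : Finset V) (x y : V) : Prop :=
  x ∉ X ∧ 2 * nbrCount G X x = X.card ∧ y ∈ X

instance [DecidableEq V] (G : SimpleGraph V) [DecidableRel G.Adj] (X : Finset V) :
    DecidableRel (Switched G X) :=
  fun x y => inferInstanceAs (Decidable (x ∉ X ∧ 2 * nbrCount G X x = X.card ∧ y ∈ X))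

/-- Godsil–McKay switching of `G` with respect to `X`: for each vertex `x` outside `X` with exactly
`|X| / 2` neighbors in `X`, adjacency and non-adjacency between `x` and `X` are interchanged;
all other pairs are left as they are. -/
def gmSwitch (G : SimpleGraph V) [DecidableRel G.Adj] (X : Finset V) : SimpleGraph V where
  Adj x y :=
    (G.Adj x y ∧ ¬ (Switched G X x y ∨ Switched G X y x)) ∨
      (¬ G.Adj x y ∧ (Switched G X x y ∨ Switched G X y x))
  symm := ⟨fun x y h => by
    rw [G.adj_comm y x, or_comm (a := Switched G X y x)]
    exact h⟩
  loopless := ⟨fun x h => by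
    rcases h with ⟨h, -⟩ | ⟨-, h⟩
    · exact G.irrefl h
    · rcases h with ⟨h1, -, h2⟩ | ⟨h1, -, h2⟩ <;> exact h1 h2⟩

instance [DecidableEq V] (G : SimpleGraph V) [DecidableRel G.Adj] (X : Finset V) :
    DecidableRel (gmSwitch G X).Adj :=
  fun x y => inferInstanceAs (Decidable
    ((G.Adj x y ∧ ¬ (Switched G X x y ∨ Switched G X y x)) ∨
      (¬ G.Adj x y ∧ (Switched G X x y ∨ Switched G X y x))))

end General

section Construction

/-- The graph `H` on `{0, …, 3k - 2}`: vertex `i` is adjacent to the residues of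
`k + i, k + i + 1, …, 2k + i - 1` modulo `3k - 1`. -/
def graphH (k : ℕ) : SimpleGraph (Fin (3 * k - 1)) :=
  SimpleGraph.fromRel
    (fun i j => ∃ d ∈ Finset.range k, (j : ℕ) = (k + i + d) % (3 * k - 1))

instance (k : ℕ) : DecidableRel (graphH k).Adj := by
  unfold graphH
  infer_instance

/-- The vertices of the graph `G`: those of `H`, followed by `a_0, …, a_k`, by `b_0, …, b_k`, and
by `c_1, …, c_{k-1}` (numbered from `0` here). -/
abbrev Vertex (k : ℕ) : Type :=
  Fin (3 * k - 1) ⊕ Fin (k + 1) ⊕ Fin (k + 1) ⊕ Fin (k - 1)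

/-- The adjacencies of the graph `G`, each listed in one direction. -/
def relG (k : ℕ) : Vertex k → Vertex k → Prop
  -- the graph `H`
  | .inl i, .inl j => (graphH k).Adj i j
  -- the clique on the vertices `a_i`
  | .inr (.inl i), .inr (.inl j) => i ≠ j
  -- `a_i ∼ b_j` for `j ≠ i`
  | .inr (.inl i), .inr (.inr (.inl j)) => i ≠ j
  -- `c_i ∼ j` for `j ∈ {0, k, …, 3k - 2}`
  | .inr (.inr (.inr _)), .inl j => (j : ℕ) = 0 ∨ k ≤ (j : ℕ)
  -- `b_i ∼ j` for `i ≤ k - 1` and `j ∈ {1, …, k - 1}`; `b_k ∼ j` for `j ∈ {2k, …, 3k - 2}`;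
  -- `b_i ∼ k + i - 1` for `1 ≤ i ≤ k`; and `b_0 ∼ 0`
  | .inr (.inr (.inl i)), .inl j =>
      ((i : ℕ) < k ∧ 1 ≤ (j : ℕ) ∧ (j : ℕ) < k) ∨
      ((i : ℕ) = k ∧ 2 * k ≤ (j : ℕ)) ∨
      (1 ≤ (i : ℕ) ∧ (j : ℕ) + 1 = k + i) ∨
      ((i : ℕ) = 0 ∧ (j : ℕ) = 0)
  | _, _ => False

instance (k : ℕ) : DecidableRel (relG k) := fun x y => by
  unfold relG
  split <;> infer_instance

/-- The graph `G`: the symmetric closure of the adjacencies above. -/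
def graphG (k : ℕ) : SimpleGraph (Vertex k) :=
  SimpleGraph.fromRel (relG k)

instance (k : ℕ) : DecidableRel (graphG k).Adj := by
  unfold graphG
  infer_instance

/-- The set `X = V(A) ∪ V(H)`. -/
def switchSet (k : ℕ) : Finset (Vertex k) :=
  Finset.univ.filter
    (fun v => (∃ i, v = Sum.inl i) ∨ (∃ i, v = Sum.inr (Sum.inl i)))

/-- The graph `G'`, obtained from `G` by Godsil–McKay switching with respect to `X`. -/
def graphG' (k : ℕ) : SimpleGraph (Vertex k) :=
  gmSwitch (graphG k) (switchSet k)

instance (k : ℕ) : DecidableRel (graphG' k).Adj := by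
  unfold graphG'
  infer_instance

end Construction

end RegularCospectral

/-! Cospectrality is the Godsil–McKay argument: conjugation by the symmetric involution `gmMatrix X`
carries the adjacency matrix of `G` to that of `G'` (`gmMatrix_conj_adjMatrix`). Both graphs are
regular of the same degree, so the three Laplacian-type matrices are affine in the adjacency matrix
and are carried along. The upper bounds on both zero forcing numbers come from explicit forcing
orders (`isZeroForcingSet_of_rank`).

The substance is `Z(G) ≥ 4k - 2`. With `q = k - 1` this says that a zero forcing set leaves at most
`2q + 4` vertices white. A forcing process is recorded by pairs `(X, Y)`, where `X` holds the
vertices that have forced and `Y` the white ones. Then `|X| + |Y|` is constant, no edge joins `X` to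
`Y` (`Hole`), and running the process backwards exchanges `X` and `Y`. Two kinds of facts are
combined. Statically, a hole avoiding `C` with neither side `Heavy` has total size at most `2q + 4`,
since each 4-cycle slice contributes at most 2 and the base at most 4 (`Hole.card_add_card_le`).
Dynamically, the configurations `StuckL`, `StuckAll` and `StuckMost` can never lead to an all-blue
graph, so they occur in no complete process, forwards or backwards.

If at least `2q + 5` vertices start white, the static bound yields `Early` at time 0: `X` avoids
`C`, and `Y` either meets `C` or is heavy. `Early.step` shows that no force can destroy this: a
violation would give either an oversized configuration with only one edge across
(`NearHole.card_add_card_le`), or a hole so close to extremal that it is stuck (`CanForce.stuckL`,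
`Live.false_of_nC_pos`). But `Early` fails at the end, where `Y` is empty. -/

namespace RegularCospectral

/-! ### Godsil–McKay switching as conjugation by an involution. -/

section Switching

variable {V : Type*} [Fintype V] [DecidableEq V]

/-- The Godsil–McKay matrix of `X`: the reflection `(2 / |X|) J - I` on `X` and the identity
elsewhere. -/
noncomputable def gmMatrix (X : Finset V) : Matrix V V ℝ :=
  fun i j => if i ∈ X then (if j ∈ X then 2 / (X.card : ℝ) else 0) - (if i = j then 1 else 0)
    else (if i = j then 1 else 0)

lemma gmMatrix_mul_apply (X : Finset V) (M : Matrix V V ℝ) (i j : V) :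
    (gmMatrix X * M) i j =
      if i ∈ X then 2 / (X.card : ℝ) * ∑ l ∈ X, M l j - M i j else M i j := by
  rw [Matrix.mul_apply]
  split_ifs with hi
  · simp only [gmMatrix, if_pos hi, sub_mul, Finset.sum_sub_distrib, ite_mul, zero_mul, one_mul,
      Finset.sum_ite_eq, Finset.mem_univ, if_true, Finset.mul_sum]
    rw [← Finset.sum_filter]
    simp
  · simp [gmMatrix, hi]

omit [Fintype V] in
lemma gmMatrix_transpose (X : Finset V) : (gmMatrix X).transpose = gmMatrix X := by
  ext i j
  simp only [Matrix.transpose_apply, gmMatrix, eq_comm (a := j) (b := i)]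
  by_cases hij : i = j
  · subst hij; rfl
  · by_cases hi : i ∈ X <;> by_cases hj : j ∈ X <;> simp [hi, hj, hij]

lemma mul_gmMatrix_apply (X : Finset V) (M : Matrix V V ℝ) (i j : V) :
    (M * gmMatrix X) i j =
      if j ∈ X then 2 / (X.card : ℝ) * ∑ l ∈ X, M i l - M i j else M i j := by
  have h : (M * gmMatrix X) i j = (gmMatrix X * M.transpose) j i := by
    rw [← Matrix.transpose_apply (gmMatrix X * M.transpose), Matrix.transpose_mul,
      gmMatrix_transpose, Matrix.transpose_transpose]
  rw [h, gmMatrix_mul_apply]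
  rfl

lemma gmMatrix_mul_self (X : Finset V) : gmMatrix X * gmMatrix X = 1 := by
  ext i j
  rw [gmMatrix_mul_apply, Matrix.one_apply]
  by_cases hi : i ∈ X
  · have hn : (X.card : ℝ) ≠ 0 := by
      exact_mod_cast (Finset.card_pos.2 ⟨i, hi⟩).ne'
    rw [if_pos hi]
    have hs : ∑ l ∈ X, gmMatrix X l j = if j ∈ X then 1 else 0 := by
      rw [Finset.sum_congr rfl (fun l hl => by
        rw [gmMatrix, if_pos hl]), Finset.sum_sub_distrib]
      by_cases hj : j ∈ X
      · simp only [hj, if_true, Finset.sum_const, nsmul_eq_mul, Finset.sum_ite_eq']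
        field_simp; norm_num
      · simp [hj]
    rw [hs]
    simp only [gmMatrix, if_pos hi]
    by_cases hj : j ∈ X <;> simp [hj]
  · simp [gmMatrix, hi]

lemma charpoly_gmMatrix_conj (X : Finset V) (M : Matrix V V ℝ) :
    (gmMatrix X * M * gmMatrix X).charpoly = M.charpoly := by
  rw [Matrix.charpoly_mul_comm, ← mul_assoc, gmMatrix_mul_self, one_mul]

variable (G : SimpleGraph V) [DecidableRel G.Adj]

omit [Fintype V] [DecidableEq V] in
lemma sum_adjMatrix_eq_nbrCount (X : Finset V) (x : V) :
    ∑ y ∈ X, G.adjMatrix ℝ x y = nbrCount G X x := by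
  simp [nbrCount, SimpleGraph.adjMatrix_apply, Finset.sum_boole]

omit [Fintype V] [DecidableEq V] in
lemma sum_adjMatrix_eq_nbrCount' (X : Finset V) (x : V) :
    ∑ y ∈ X, G.adjMatrix ℝ y x = nbrCount G X x := by
  rw [← sum_adjMatrix_eq_nbrCount]
  exact Finset.sum_congr rfl fun y _ => by
    simp [SimpleGraph.adjMatrix_apply, G.adj_comm]

omit [Fintype V] in
-- The factor `2 * nbrCount / |X|` equals 0, 1 or 2 in the three cases of a switching set, so
-- subtracting the old entry keeps a zero row, complements a half row and keeps a full row.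
lemma nbrCount_switch_entry (X : Finset V) (h : IsSwitchingSet G X) {x y : V} (hx : x ∉ X)
    (hy : y ∈ X) :
    2 / (X.card : ℝ) * (nbrCount G X x : ℝ) - (if G.Adj x y then 1 else 0) =
      if (gmSwitch G X).Adj x y then 1 else 0 := by
  have hpos : 0 < X.card := Finset.card_pos.2 ⟨y, hy⟩
  have hn : (X.card : ℝ) ≠ 0 := by exact_mod_cast hpos.ne'
  have hsw : (gmSwitch G X).Adj x y ↔ (G.Adj x y ∧ ¬ 2 * nbrCount G X x = X.card) ∨
      (¬ G.Adj x y ∧ 2 * nbrCount G X x = X.card) := by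
    simp [gmSwitch, Switched, hx, hy]
  simp only [hsw]
  rcases h.2 x hx with h0 | h0 | h0
  · have hna : ¬ G.Adj x y := fun ha => by
      have : y ∈ X.filter (fun z => G.Adj x z) := Finset.mem_filter.2 ⟨hy, ha⟩
      rw [nbrCount, Finset.card_eq_zero] at h0
      simp [h0] at this
    simp [h0, hna, hpos.ne]
  · have : 2 / (X.card : ℝ) * (nbrCount G X x : ℝ) = 1 := by
      have : (nbrCount G X x : ℝ) = X.card / 2 := by
        rw [← h0]; push_cast; ring
      rw [this]
      field_simp
    rw [this]
    by_cases ha : G.Adj x y <;> simp [ha, h0]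
  · have ha : G.Adj x y := by
      have := Finset.card_filter_eq_iff.1 h0
      exact this y hy
    have h2 : ¬ 2 * nbrCount G X x = X.card := by omega
    simp only [h0, ha] at h2 ⊢
    simp [h2]
    field_simp; norm_num

/-- On the block inside `X`, regularity makes the reflection commute with the adjacency matrix, so
this block is unchanged; the mixed blocks are `nbrCount_switch_entry`. -/
lemma gmMatrix_conj_adjMatrix (X : Finset V) (h : IsSwitchingSet G X) :
    gmMatrix X * G.adjMatrix ℝ * gmMatrix X = (gmSwitch G X).adjMatrix ℝ := by
  obtain ⟨d, hd⟩ := h.1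
  ext i j
  simp only [mul_gmMatrix_apply, gmMatrix_mul_apply, sum_adjMatrix_eq_nbrCount']
  by_cases hi : i ∈ X <;> by_cases hj : j ∈ X
  · have hn : (X.card : ℝ) ≠ 0 := by
      exact_mod_cast (Finset.card_pos.2 ⟨i, hi⟩).ne'
    simp only [hi, hj, if_true, Finset.sum_sub_distrib, ← Finset.mul_sum, hd j hj,
      sum_adjMatrix_eq_nbrCount, hd i hi]
    have : ∑ l ∈ X, (nbrCount G X l : ℝ) = X.card * d := by
      rw [Finset.sum_congr rfl fun l hl => by rw [hd l hl]]; simp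
    rw [this]
    have e : (gmSwitch G X).Adj i j ↔ G.Adj i j := by simp [gmSwitch, Switched, hi, hj]
    simp only [SimpleGraph.adjMatrix_apply, e]
    field_simp; ring
  · simp only [hi, hj, if_true, if_false]
    simp only [SimpleGraph.adjMatrix_apply, G.adj_comm i j, (gmSwitch G X).adj_comm i j]
    exact nbrCount_switch_entry G X h hj hi
  · simp only [hi, hj, if_true, if_false, sum_adjMatrix_eq_nbrCount]
    simp only [SimpleGraph.adjMatrix_apply]
    exact nbrCount_switch_entry G X h hi hj
  · have e : (gmSwitch G X).Adj i j ↔ G.Adj i j := by simp [gmSwitch, Switched, hi, hj]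
    simp only [hi, hj, if_false, SimpleGraph.adjMatrix_apply, e]

lemma eigenvalueMultiset_eq_of_conj {X : Finset V} {M N : Matrix V V ℝ}
    (h : gmMatrix X * M * gmMatrix X = N) : eigenvalueMultiset M = eigenvalueMultiset N := by
  rw [eigenvalueMultiset, eigenvalueMultiset, ← h, charpoly_gmMatrix_conj]

lemma degMatrix_eq_smul_one {H : SimpleGraph V} [DecidableRel H.Adj] {r : ℕ}
    (hr : H.IsRegularOfDegree r) : H.degMatrix ℝ = (r : ℝ) • (1 : Matrix V V ℝ) := by
  ext i j
  by_cases hij : i = j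
  · subst hij; simp [SimpleGraph.degMatrix, hr.degree_eq]
  · simp [SimpleGraph.degMatrix, hij]

lemma normalizedLapMatrix_eq_smul {H : SimpleGraph V} [DecidableRel H.Adj] {r : ℕ}
    (hr : H.IsRegularOfDegree r) :
    normalizedLapMatrix H = ((Real.sqrt r)⁻¹ * (Real.sqrt r)⁻¹) • H.lapMatrix ℝ := by
  have : Matrix.diagonal (fun v => (Real.sqrt (H.degree v))⁻¹) =
      (Real.sqrt r)⁻¹ • (1 : Matrix V V ℝ) := by
    ext i j
    by_cases hij : i = j
    · subst hij; simp [hr.degree_eq]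
    · simp [hij]
  rw [normalizedLapMatrix, this]
  simp [smul_smul]

lemma gmMatrix_conj_smul_one (X : Finset V) (r : ℝ) :
    gmMatrix X * (r • (1 : Matrix V V ℝ)) * gmMatrix X = r • (1 : Matrix V V ℝ) := by
  simp [gmMatrix_mul_self]

/-- Godsil–McKay switching between regular graphs preserves the spectra of the adjacency,
Laplacian, signless Laplacian and normalized Laplacian matrices. -/
lemma cospectral_gmSwitch (X : Finset V) (h : IsSwitchingSet G X) {r : ℕ}
    (hG : G.IsRegularOfDegree r) (hG' : (gmSwitch G X).IsRegularOfDegree r) :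
    eigenvalueMultiset (G.adjMatrix ℝ) = eigenvalueMultiset ((gmSwitch G X).adjMatrix ℝ) ∧
    eigenvalueMultiset (G.lapMatrix ℝ) = eigenvalueMultiset ((gmSwitch G X).lapMatrix ℝ) ∧
    eigenvalueMultiset (signlessLapMatrix G) =
      eigenvalueMultiset (signlessLapMatrix (gmSwitch G X)) ∧
    eigenvalueMultiset (normalizedLapMatrix G) =
      eigenvalueMultiset (normalizedLapMatrix (gmSwitch G X)) := by
  have hA := gmMatrix_conj_adjMatrix G X h
  have hL : gmMatrix X * G.lapMatrix ℝ * gmMatrix X = (gmSwitch G X).lapMatrix ℝ := by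
    rw [SimpleGraph.lapMatrix, SimpleGraph.lapMatrix, degMatrix_eq_smul_one hG,
      degMatrix_eq_smul_one hG', mul_sub, sub_mul, hA, gmMatrix_conj_smul_one]
  refine ⟨eigenvalueMultiset_eq_of_conj hA, eigenvalueMultiset_eq_of_conj hL,
    eigenvalueMultiset_eq_of_conj (X := X) ?_, eigenvalueMultiset_eq_of_conj (X := X) ?_⟩
  · rw [signlessLapMatrix, signlessLapMatrix, degMatrix_eq_smul_one hG,
      degMatrix_eq_smul_one hG', mul_add, add_mul, hA, gmMatrix_conj_smul_one]
  · rw [normalizedLapMatrix_eq_smul hG, normalizedLapMatrix_eq_smul hG', ← hL]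
    simp

end Switching

/-! ### A relabelling of `G` in which adjacency needs no modular arithmetic. -/

section Model

/-- A relabelling of the vertices of `graphG (q + 1)`. The vertices of `H` other than `0` and
`2k - 1` are split into the three intervals `Q t = t + 1`, `L t = k + t` and `R t = 2k + t`;
moreover `Lk = 2k - 1`, `Rk = 0`, `b t = b_{t+1}`, `bk = b_k`. -/
inductive Vtx (q : ℕ)
  | Q (t : Fin q)
  | L (t : Fin q)
  | R (t : Fin q)
  | b (t : Fin q)
  | c (t : Fin q)
  | a (t : Fin (q + 2))
  | Lk
  | Rk
  | bk
  | b0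
  deriving DecidableEq

variable {q : ℕ}

/-- The model as a sum type. -/
def Vtx.equivSum (q : ℕ) : Vtx q ≃
    Fin q ⊕ Fin q ⊕ Fin q ⊕ Fin q ⊕ Fin q ⊕ Fin (q + 2) ⊕ Unit ⊕ Unit ⊕ Unit ⊕ Unit where
  toFun
    | .Q t => .inl t
    | .L t => .inr (.inl t)
    | .R t => .inr (.inr (.inl t))
    | .b t => .inr (.inr (.inr (.inl t)))
    | .c t => .inr (.inr (.inr (.inr (.inl t))))
    | .a t => .inr (.inr (.inr (.inr (.inr (.inl t)))))
    | .Lk => .inr (.inr (.inr (.inr (.inr (.inr (.inl ()))))))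
    | .Rk => .inr (.inr (.inr (.inr (.inr (.inr (.inr (.inl ())))))))
    | .bk => .inr (.inr (.inr (.inr (.inr (.inr (.inr (.inr (.inl ()))))))))
    | .b0 => .inr (.inr (.inr (.inr (.inr (.inr (.inr (.inr (.inr ()))))))))
  invFun
    | .inl t => .Q t
    | .inr (.inl t) => .L t
    | .inr (.inr (.inl t)) => .R t
    | .inr (.inr (.inr (.inl t))) => .b t
    | .inr (.inr (.inr (.inr (.inl t)))) => .c t
    | .inr (.inr (.inr (.inr (.inr (.inl t))))) => .a t
    | .inr (.inr (.inr (.inr (.inr (.inr (.inl ())))))) => .Lk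
    | .inr (.inr (.inr (.inr (.inr (.inr (.inr (.inl ()))))))) => .Rk
    | .inr (.inr (.inr (.inr (.inr (.inr (.inr (.inr (.inl ())))))))) => .bk
    | .inr (.inr (.inr (.inr (.inr (.inr (.inr (.inr (.inr ())))))))) => .b0
  left_inv x := by cases x <;> rfl
  right_inv x := by
    rcases x with t | t | t | t | t | t | ⟨⟩ | ⟨⟩ | ⟨⟩ | ⟨⟩ <;> rfl

instance : Fintype (Vtx q) := Fintype.ofEquiv _ (Vtx.equivSum q).symm

lemma Vtx.sum_eq {M : Type*} [AddCommMonoid M] (f : Vtx q → M) :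
    ∑ v, f v = ∑ t, f (.Q t) + (∑ t, f (.L t) + (∑ t, f (.R t) + (∑ t, f (.b t) +
      (∑ t, f (.c t) + (∑ t, f (.a t) + (f .Lk + (f .Rk + (f .bk + f .b0)))))))) := by
  rw [← (Vtx.equivSum q).symm.sum_comp]
  simp only [Fintype.sum_sum_type, Finset.univ_unique, Finset.sum_singleton]
  rfl

/-- Adjacency in `graphG (q + 1)`, in terms of the relabelling. -/
def Vtx.Adj : Vtx q → Vtx q → Prop
  | .L s, .R t => s ≤ t
  | .R t, .L s => s ≤ t
  | .L s, .Q t => t < s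
  | .Q t, .L s => t < s
  | .R s, .Q t => s ≤ t
  | .Q t, .R s => s ≤ t
  | .Lk, .Q _ => True
  | .Q _, .Lk => True
  | .Lk, .Rk => True
  | .Rk, .Lk => True
  | .Rk, .L _ => True
  | .L _, .Rk => True
  | .b s, .L t => s = t
  | .L t, .b s => s = t
  | .b _, .Q _ => True
  | .Q _, .b _ => True
  | .b0, .Q _ => True
  | .Q _, .b0 => True
  | .b0, .Rk => True
  | .Rk, .b0 => True
  | .bk, .Lk => True
  | .Lk, .bk => True
  | .bk, .R _ => True
  | .R _, .bk => True
  | .c _, .L _ => True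
  | .L _, .c _ => True
  | .c _, .R _ => True
  | .R _, .c _ => True
  | .c _, .Lk => True
  | .Lk, .c _ => True
  | .c _, .Rk => True
  | .Rk, .c _ => True
  | .a s, .a t => s ≠ t
  | .a s, .b t => (s : ℕ) ≠ t + 1
  | .b t, .a s => (s : ℕ) ≠ t + 1
  | .a s, .b0 => (s : ℕ) ≠ 0
  | .b0, .a s => (s : ℕ) ≠ 0
  | .a s, .bk => (s : ℕ) ≠ q + 1
  | .bk, .a s => (s : ℕ) ≠ q + 1
  | _, _ => False

lemma Vtx.Adj.symm {x y : Vtx q} (h : Vtx.Adj x y) : Vtx.Adj y x := by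
  cases x <;> cases y <;> first | exact h | exact fun e => h e.symm

lemma Vtx.adj_irrefl (x : Vtx q) : ¬ Vtx.Adj x x := by
  cases x <;> simp [Vtx.Adj]

/-- The vertex of `graphG (q + 1)` with a given label. -/
def Vtx.toVertex : Vtx q → Vertex (q + 1)
  | .Q t => .inl ⟨t + 1, by omega⟩
  | .L t => .inl ⟨q + 1 + t, by omega⟩
  | .R t => .inl ⟨2 * q + 2 + t, by omega⟩
  | .b t => .inr (.inr (.inl ⟨t + 1, by omega⟩))
  | .c t => .inr (.inr (.inr t))
  | .a t => .inr (.inl t)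
  | .Lk => .inl ⟨2 * q + 1, by omega⟩
  | .Rk => .inl ⟨0, by omega⟩
  | .bk => .inr (.inr (.inl ⟨q + 1, by omega⟩))
  | .b0 => .inr (.inr (.inl ⟨0, by omega⟩))

lemma Vtx.toVertex_injective : Function.Injective (Vtx.toVertex (q := q)) := by
  intro x y h
  cases x <;> cases y <;> simp [Vtx.toVertex, Fin.ext_iff] at h ⊢ <;> omega

lemma Vtx.toVertex_surjective : Function.Surjective (Vtx.toVertex (q := q)) := by
  rintro (⟨j, hj⟩ | i | ⟨i, hi⟩ | i)
  · rcases Nat.eq_zero_or_pos j with rfl | h0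
    · exact ⟨.Rk, rfl⟩
    by_cases h1 : j < q + 1
    · exact ⟨.Q ⟨j - 1, by omega⟩, by simp only [Vtx.toVertex]; congr 2; omega⟩
    by_cases h2 : j < 2 * q + 1
    · exact ⟨.L ⟨j - (q + 1), by omega⟩, by simp only [Vtx.toVertex]; congr 2; omega⟩
    by_cases h3 : j = 2 * q + 1
    · subst h3; exact ⟨.Lk, rfl⟩
    · exact ⟨.R ⟨j - (2 * q + 2), by omega⟩, by simp only [Vtx.toVertex]; congr 2; omega⟩
  · exact ⟨.a i, rfl⟩
  · rcases Nat.eq_zero_or_pos i with rfl | h0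
    · exact ⟨.b0, rfl⟩
    by_cases h1 : i < q + 1
    · exact ⟨.b ⟨i - 1, by omega⟩, by simp only [Vtx.toVertex]; congr 4; omega⟩
    · have : i = q + 1 := by omega
      subst this; exact ⟨.bk, rfl⟩
  · exact ⟨.c i, rfl⟩

/-- The relabelling as an equivalence. -/
noncomputable def Vtx.equivVertex (q : ℕ) : Vtx q ≃ Vertex (q + 1) :=
  Equiv.ofBijective Vtx.toVertex ⟨Vtx.toVertex_injective, Vtx.toVertex_surjective⟩

/-- The admissible differences `k, …, 2k - 1` are closed under negation modulo `3k - 1`, so the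
defining relation is already symmetric, and its two cases tell whether the sum wraps around. -/
lemma graphH_adj_iff (k : ℕ) (i j : Fin (3 * k - 1)) :
    (graphH k).Adj i j ↔
      (k + i ≤ (j : ℕ) ∧ (j : ℕ) < 2 * k + i) ∨ (k + j ≤ (i : ℕ) ∧ (i : ℕ) < 2 * k + j) := by
  have key : ∀ i j : Fin (3 * k - 1),
      (∃ d ∈ Finset.range k, (j : ℕ) = (k + i + d) % (3 * k - 1)) ↔
      (k + i ≤ (j : ℕ) ∧ (j : ℕ) < 2 * k + i) ∨ (k + j ≤ (i : ℕ) ∧ (i : ℕ) < 2 * k + j) := by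
    intro i j
    have hi := i.2
    have hj := j.2
    constructor
    · rintro ⟨d, hd, h⟩
      rw [Finset.mem_range] at hd
      by_cases hlt : k + i + d < 3 * k - 1
      · rw [Nat.mod_eq_of_lt hlt] at h; omega
      · rw [Nat.mod_eq_sub_mod (by omega), Nat.mod_eq_of_lt (by omega)] at h; omega
    · rintro (h | h)
      · refine ⟨j - i - k, by rw [Finset.mem_range]; omega, ?_⟩
        rw [Nat.mod_eq_of_lt (by omega)]; omega
      · refine ⟨j + (3 * k - 1) - i - k, by rw [Finset.mem_range]; omega, ?_⟩
        rw [Nat.mod_eq_sub_mod (by omega), Nat.mod_eq_of_lt (by omega)]; omega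
  rw [graphH, SimpleGraph.fromRel_adj, key, key, Ne, Fin.ext_iff]
  omega

lemma graphG_adj_iff (x y : Vtx q) :
    (graphG (q + 1)).Adj x.toVertex y.toVertex ↔ Vtx.Adj x y := by
  rw [graphG, SimpleGraph.fromRel_adj]
  cases x <;> cases y <;>
    simp only [Vtx.toVertex, relG, Vtx.Adj, graphH_adj_iff, ne_eq, Sum.inl.injEq, Sum.inr.injEq,
      reduceCtorEq, Fin.ext_iff, Fin.le_def, Fin.lt_def, not_false_eq_true, true_and, or_false,
      false_or, or_self, iff_self, iff_true, iff_false,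
      not_true_eq_false, and_false, and_true, false_and, or_true, true_or] <;>
    omega

end Model

/-! ### Degrees, the switching set, and adjacency in `G'`. -/

section Counting

variable {q : ℕ}

lemma sum_fin_lt (s : Fin q) : ∑ t : Fin q, (if t < s then 1 else 0) = (s : ℕ) := by
  simp [Finset.sum_boole, Finset.filter_gt_eq_Iio]

lemma sum_fin_ge (s : Fin q) : ∑ t : Fin q, (if s ≤ t then 1 else 0) = q - (s : ℕ) := by
  simp [Finset.sum_boole, Finset.filter_le_eq_Ici]

lemma sum_fin_gt (s : Fin q) : ∑ t : Fin q, (if s < t then 1 else 0) = q - 1 - (s : ℕ) := by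
  simp [Finset.sum_boole, Finset.filter_lt_eq_Ioi]

lemma sum_fin_le (s : Fin q) : ∑ t : Fin q, (if t ≤ s then 1 else 0) = (s : ℕ) + 1 := by
  simp [Finset.sum_boole, Finset.filter_ge_eq_Iic]

lemma sum_fin_val_ne {n m : ℕ} (h : m < n + 1) :
    ∑ t : Fin (n + 1), (if (t : ℕ) = m then 0 else 1) = n := by
  have : ∀ t : Fin (n + 1), ((t : ℕ) = m) ↔ t = ⟨m, h⟩ := fun t => by simp [Fin.ext_iff]
  simp only [this, ← ite_not (p := _ = _), Finset.sum_boole, Finset.filter_ne',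
    Finset.card_erase_of_mem, Finset.mem_univ, Finset.card_univ, Fintype.card_fin, Nat.cast_id]
  rfl

lemma sum_fin_ne {n : ℕ} (s : Fin (n + 1)) :
    ∑ t : Fin (n + 1), (if s = t then 0 else 1) = n := by
  have := sum_fin_val_ne s.2
  simpa only [← Fin.ext_iff, eq_comm (b := s)] using this

lemma sum_fin_eq_left (s : Fin q) : ∑ t : Fin q, (if s = t then 0 else 1) = q - 1 := by
  obtain ⟨n, rfl⟩ : ∃ n, q = n + 1 := ⟨q - 1, by have := s.2; omega⟩
  exact sum_fin_ne s

lemma sum_fin_eq_right (s : Fin q) : ∑ t : Fin q, (if t = s then 0 else 1) = q - 1 := by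
  simpa only [eq_comm] using sum_fin_eq_left s

lemma sum_fin_val_eq {n m : ℕ} (h : m < n) :
    ∑ t : Fin n, (if (t : ℕ) = m then 1 else 0) = 1 := by
  have : ∀ t : Fin n, ((t : ℕ) = m) ↔ t = ⟨m, h⟩ := fun t => by simp [Fin.ext_iff]
  simp [this]

lemma sum_fin_val_add_eq (s : Fin (q + 2)) :
    ∑ t : Fin q, (if (s : ℕ) = t + 1 then 1 else 0) + (if (s : ℕ) = q + 1 then 1 else 0) +
      (if s = 0 then 1 else 0) = 1 := by
  have h : ∑ t : Fin (q + 2), (if s = t then 1 else 0) = 1 := by simp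
  rw [Fin.sum_univ_succ, Fin.sum_univ_castSucc] at h
  simp only [Fin.ext_iff, Fin.val_zero, Fin.val_succ, Fin.val_castSucc, Fin.val_last] at h ⊢
  omega

lemma sum_fin_val_add_ne (s : Fin (q + 2)) :
    ∑ t : Fin q, (if (s : ℕ) = t + 1 then 0 else 1) + (if (s : ℕ) = q + 1 then 0 else 1) +
      (if s = 0 then 0 else 1) = q + 1 := by
  have h := sum_fin_ne s
  rw [Fin.sum_univ_succ, Fin.sum_univ_castSucc] at h
  simp only [Fin.ext_iff, Fin.val_zero, Fin.val_succ, Fin.val_castSucc, Fin.val_last] at h ⊢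
  omega

noncomputable instance : DecidableRel (Vtx.Adj (q := q)) := Classical.decRel _

/-- The labels of the vertices in `switchSet`. -/
def Vtx.InX : Vtx q → Bool
  | .Q _ => true
  | .L _ => true
  | .R _ => true
  | .a _ => true
  | .Lk => true
  | .Rk => true
  | _ => false

lemma mem_switchSet_iff (x : Vtx q) : x.toVertex ∈ switchSet (q + 1) ↔ x.InX = true := by
  cases x <;> simp [switchSet, Vtx.toVertex, Vtx.InX]

lemma card_filter_vertex (P : Vertex (q + 1) → Prop) [DecidablePred P] (P' : Vtx q → Prop)
    [DecidablePred P'] (h : ∀ v, P v.toVertex ↔ P' v) :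
    (Finset.univ.filter P).card = ∑ v, if P' v then 1 else 0 := by
  rw [Finset.card_filter, ← (Vtx.equivVertex q).sum_comp]
  exact Finset.sum_congr rfl fun v _ => by
    simp only [show Vtx.equivVertex q v = v.toVertex from rfl, h]

lemma card_switchSet : (switchSet (q + 1)).card = 4 * (q + 1) := by
  have : switchSet (q + 1) = Finset.univ.filter (fun v => v ∈ switchSet (q + 1)) := by simp
  rw [this, card_filter_vertex _ (fun v => v.InX = true) mem_switchSet_iff, Vtx.sum_eq]
  simp [Vtx.InX]
  omega

lemma nbrCount_eq_sum (x : Vtx q) :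
    nbrCount (graphG (q + 1)) (switchSet (q + 1)) x.toVertex =
      ∑ v, if v.InX = true ∧ Vtx.Adj x v then 1 else 0 := by
  rw [← card_filter_vertex (fun v => v ∈ switchSet (q + 1) ∧ (graphG (q + 1)).Adj x.toVertex v)
    _ fun v => by rw [mem_switchSet_iff, graphG_adj_iff], nbrCount]
  congr 1
  ext v
  simp

lemma nbrCount_inX (x : Vtx q) (hx : x.InX = true) :
    nbrCount (graphG (q + 1)) (switchSet (q + 1)) x.toVertex = q + 1 := by
  rw [nbrCount_eq_sum, Vtx.sum_eq]
  cases x <;> simp [Vtx.InX, Vtx.Adj, -Finset.sum_boole, sum_fin_lt, sum_fin_ge, sum_fin_gt,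
    sum_fin_le, sum_fin_ne] at hx ⊢ <;> omega

lemma nbrCount_not_inX (x : Vtx q) (hx : x.InX = false) :
    nbrCount (graphG (q + 1)) (switchSet (q + 1)) x.toVertex = 2 * (q + 1) := by
  rw [nbrCount_eq_sum, Vtx.sum_eq]
  have h0 := sum_fin_val_ne (n := q + 1) (m := 0) (by omega)
  have h1 := sum_fin_val_ne (n := q + 1) (m := q + 1) (by omega)
  have h2 := fun t : Fin q => sum_fin_val_ne (n := q + 1) (m := t + 1) (by omega)
  simp only [Fin.val_eq_zero_iff] at h0
  cases x <;> simp [Vtx.InX, Vtx.Adj, -Finset.sum_boole, h0, h1, h2] at hx ⊢ <;> omega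

lemma graphG_isRegularOfDegree : (graphG (q + 1)).IsRegularOfDegree (2 * (q + 1)) := by
  intro v
  obtain ⟨x, rfl⟩ := Vtx.toVertex_surjective v
  rw [← SimpleGraph.card_neighborFinset_eq_degree, SimpleGraph.neighborFinset_eq_filter,
    card_filter_vertex _ (fun v => (v.InX = true ∧ Vtx.Adj x v) ∨ (v.InX = false ∧ Vtx.Adj x v))
    (fun v => by rw [graphG_adj_iff]; cases v.InX <;> simp), Vtx.sum_eq]
  have h0 := sum_fin_val_ne (n := q + 1) (m := 0) (by omega)
  have h1 := sum_fin_val_ne (n := q + 1) (m := q + 1) (by omega)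
  have h2 := fun t : Fin q => sum_fin_val_ne (n := q + 1) (m := t + 1) (by omega)
  simp only [Fin.val_eq_zero_iff] at h0
  cases x with
  | a s =>
    have := sum_fin_val_add_ne s
    simp [Vtx.Adj, Vtx.InX, -Finset.sum_boole, sum_fin_ne] at this ⊢
    omega
  | _ =>
    simp [Vtx.Adj, Vtx.InX, -Finset.sum_boole, h0, h1, h2, sum_fin_lt, sum_fin_ge, sum_fin_gt,
      sum_fin_le]
    try omega

lemma isSwitchingSet : IsSwitchingSet (graphG (q + 1)) (switchSet (q + 1)) := by
  refine ⟨⟨q + 1, fun v hv => ?_⟩, fun v hv => Or.inr (Or.inl ?_)⟩ <;>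
    obtain ⟨x, rfl⟩ := Vtx.toVertex_surjective v
  · exact nbrCount_inX x ((mem_switchSet_iff x).1 hv)
  · rw [nbrCount_not_inX x (by simpa [mem_switchSet_iff] using hv), card_switchSet]
    omega

/-- Adjacency in `graphG' (q + 1)`, in terms of the relabelling. -/
def Vtx.Adj' (x y : Vtx q) : Prop :=
  (x.InX = y.InX ∧ Vtx.Adj x y) ∨ (x.InX ≠ y.InX ∧ ¬ Vtx.Adj x y)

noncomputable instance : DecidableRel (Vtx.Adj' (q := q)) := Classical.decRel _

/-- Every vertex outside `X` has exactly `|X| / 2` neighbors in `X` (`nbrCount_not_inX`), so the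
switching complements all pairs between `X` and its complement. -/
lemma graphG'_adj_iff (x y : Vtx q) :
    (graphG' (q + 1)).Adj x.toVertex y.toVertex ↔ Vtx.Adj' x y := by
  have hs : ∀ x y : Vtx q, Switched (graphG (q + 1)) (switchSet (q + 1)) x.toVertex y.toVertex ↔
      (x.InX = false ∧ y.InX = true) := by
    intro x y
    rw [Switched, mem_switchSet_iff, mem_switchSet_iff, card_switchSet]
    constructor
    · rintro ⟨h1, -, h3⟩
      exact ⟨by simpa using h1, h3⟩
    · rintro ⟨h1, h3⟩
      exact ⟨by simp [h1], by rw [nbrCount_not_inX x h1]; omega, h3⟩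
  rw [graphG', gmSwitch, Vtx.Adj']
  simp only [hs, graphG_adj_iff]
  cases x.InX <;> cases y.InX <;> simp

lemma graphG'_isRegularOfDegree : (graphG' (q + 1)).IsRegularOfDegree (2 * (q + 1)) := by
  intro v
  obtain ⟨x, rfl⟩ := Vtx.toVertex_surjective v
  rw [← SimpleGraph.card_neighborFinset_eq_degree, SimpleGraph.neighborFinset_eq_filter,
    card_filter_vertex _ (Vtx.Adj' x) (fun v => graphG'_adj_iff x v), Vtx.sum_eq]
  have h3 := sum_fin_val_eq (n := q + 2) (m := q + 1) (by omega)
  have h4 := fun t : Fin q => sum_fin_val_eq (n := q + 2) (m := t + 1) (by omega)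
  cases x with
  | a s =>
    have := sum_fin_val_add_eq s
    simp only [Vtx.Adj', Vtx.Adj, Vtx.InX]
    simp [-Finset.sum_boole, sum_fin_ne] at this ⊢
    omega
  | b t =>
    have := t.2
    simp [Vtx.Adj', Vtx.Adj, Vtx.InX, -Finset.sum_boole, h4, sum_fin_eq_left]
    omega
  | _ =>
    simp [Vtx.Adj', Vtx.Adj, Vtx.InX, -Finset.sum_boole, h3, sum_fin_lt, sum_fin_ge,
      sum_fin_gt, sum_fin_le, sum_fin_eq_right]
    try omega

end Counting

/-! ### Explicit zero forcing sets of `G` and `G'`. -/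

section UpperBound

/-- A set is zero forcing if every white vertex has a forcing vertex that is blue, and whose other
white neighbors have turned blue, at an earlier stage. -/
lemma isZeroForcingSet_of_rank {V : Type*} [Fintype V] [DecidableEq V] (G : SimpleGraph V)
    (S : Finset V) (p : V → V) (ρ : V → ℕ)
    (h : ∀ w, w ∉ S → G.Adj (p w) w ∧ (p w ∈ S ∨ ρ (p w) < ρ w) ∧
      ∀ w', w' ∉ S → w' ≠ w → G.Adj (p w) w' → ρ w' < ρ w) :
    IsZeroForcingSet G S := by
  suffices H : ∀ n (B : Finset V), S ⊆ B → Bᶜ.card = n →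
      Relation.ReflTransGen (ForceStep G) B Finset.univ from H _ S subset_rfl rfl
  intro n
  induction n with
  | zero =>
    intro B _ hB
    rw [Finset.card_eq_zero, Finset.compl_eq_empty_iff] at hB
    rw [hB]
  | succ n ih =>
    intro B hSB hB
    -- A white vertex of least rank can be forced next: everything of smaller rank is already blue.
    obtain ⟨w, hw, hmin⟩ := Finset.exists_min_image Bᶜ ρ (Finset.card_pos.1 (by omega))
    rw [Finset.mem_compl] at hw
    have hnS : ∀ x, x ∉ B → x ∉ S := fun x hx hxS => hx (hSB hxS)
    have hlt : ∀ x, ρ x < ρ w → x ∈ B := by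
      intro x hx
      by_contra hxB
      exact absurd (hmin x (Finset.mem_compl.2 hxB)) (by omega)
    obtain ⟨h1, h2, h3⟩ := h w (hnS w hw)
    refine Relation.ReflTransGen.head
      ⟨p w, h2.elim (fun h => hSB h) (hlt _), w, hw, h1, fun x hx hxB => ?_, rfl⟩
      (ih (insert w B) (hSB.trans (Finset.subset_insert _ _)) ?_)
    · by_contra hne
      exact hxB (hlt x (h3 x (hnS x hxB) hne hx))
    · rw [Finset.compl_insert, Finset.card_erase_of_mem (Finset.mem_compl.2 hw), hB]
      rfl

variable {q : ℕ}

lemma zeroForcingNumber_le_of_rank (G : SimpleGraph (Vertex (q + 1))) (A : Vtx q → Vtx q → Prop)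
    (hA : ∀ x y, G.Adj x.toVertex y.toVertex ↔ A x y) (W : Vtx q → Bool) (p : Vtx q → Vtx q)
    (ρ : Vtx q → ℕ)
    (h : ∀ w, W w = true → A (p w) w ∧ (W (p w) = false ∨ ρ (p w) < ρ w) ∧
      ∀ w', W w' = true → w' ≠ w → A (p w) w' → ρ w' < ρ w) :
    zeroForcingNumber G ≤ ∑ v, if W v = false then 1 else 0 := by
  let e := Vtx.equivVertex q
  refine Nat.sInf_le ⟨Finset.univ.filter (fun v => W (e.symm v) = false), ?_, ?_⟩
  · refine isZeroForcingSet_of_rank G _ (fun v => e (p (e.symm v))) (fun v => ρ (e.symm v)) ?_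
    intro v hv
    obtain ⟨w, rfl⟩ := e.surjective v
    simp only [Finset.mem_filter, Finset.mem_univ, true_and, Equiv.symm_apply_apply,
      Bool.not_eq_false] at hv ⊢
    obtain ⟨h1, h2, h3⟩ := h w hv
    refine ⟨(hA _ _).2 h1, h2, fun v' hv' hne hadj => ?_⟩
    obtain ⟨w', rfl⟩ := e.surjective v'
    rw [Equiv.symm_apply_apply] at hv' ⊢
    exact h3 w' hv' (fun he => hne (he ▸ rfl)) ((hA _ _).1 hadj)
  · exact card_filter_vertex _ _ fun v => by
      rw [show v.toVertex = e v from rfl, Equiv.symm_apply_apply]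

/-- The white vertices of a small zero forcing set of `graphG`. -/
def Vtx.white : Vtx q → Bool
  | .a i => (i : ℕ) = 1
  | .b0 => true
  | .L _ => true
  | .R _ => true
  | .Lk => true
  | .Rk => true
  | _ => false

/-- The vertex that forces a given white vertex of `graphG`. -/
def Vtx.forcer : Vtx q → Vtx q
  | .a _ => .a 0
  | .b0 => .a 1
  | .L t => .b t
  | .R t => .Q t
  | .Lk => .Rk
  | .Rk => .b0
  | x => x

/-- The order in which the white vertices of `graphG` are forced. -/
def Vtx.rank : Vtx q → ℕ
  | .b0 => 1
  | .L _ => 2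
  | .Rk => 2
  | .Lk => 3
  | .R t => t + 4
  | _ => 0

lemma zeroForcingNumber_graphG_le : zeroForcingNumber (graphG (q + 1)) ≤ 4 * (q + 1) - 2 := by
  refine (zeroForcingNumber_le_of_rank _ Vtx.Adj graphG_adj_iff Vtx.white Vtx.forcer Vtx.rank
    ?_).trans ?_
  · intro w hw
    refine ⟨?_, ?_, fun w' hw' hne hadj => ?_⟩
    · cases w <;> simp_all [Vtx.white, Vtx.forcer, Vtx.Adj, Fin.ext_iff]
    · cases w <;> simp_all [Vtx.white, Vtx.forcer, Vtx.rank]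
    · cases w <;> cases w' <;>
        simp_all [Vtx.white, Vtx.forcer, Vtx.Adj, Vtx.rank, Fin.ext_iff]
      omega
  -- The white vertices number `1 + 1 + q + q + 1 + 1 = 2q + 4` out of `6q + 6`.
  · rw [Vtx.sum_eq]
    have := sum_fin_val_ne (n := q + 1) (m := 1) (by omega)
    simp [Vtx.white, -Finset.sum_boole, this]
    omega

/-- The white vertices of a small zero forcing set of `graphG'`. -/
def Vtx.white' : Vtx q → Bool
  | .a _ => true
  | .b0 => true
  | .L t => (t : ℕ) = 0
  | .Q _ => true
  | .c t => (t : ℕ) = 0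
  | _ => false

/-- The vertex that forces a given white vertex of `graphG'`. -/
def Vtx.forcer' : Vtx q → Vtx q
  | .a i => if (i : ℕ) = 0 then .b0 else if h : (i : ℕ) - 1 < q then .b ⟨i - 1, h⟩ else .a 0
  | .b0 => if h : 0 < q then .L ⟨0, h⟩ else .b0
  | .L _ => .Rk
  | .Q t => if h : (t : ℕ) + 1 < q then .L ⟨t + 1, h⟩ else .Lk
  | .c t => .Q t
  | x => x

/-- The order in which the white vertices of `graphG'` are forced. -/
def Vtx.rank' : Vtx q → ℕ
  | .b0 => 1
  | .Q t => if (t : ℕ) = 0 then 2 else t + 4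
  | .c _ => 3
  | .a t => if (t : ℕ) = q + 1 then q + 5 else q + 4
  | _ => 0

lemma zeroForcingNumber_graphG'_le (hq : 0 < q) :
    zeroForcingNumber (graphG' (q + 1)) ≤ 4 * (q + 1) - 3 := by
  refine (zeroForcingNumber_le_of_rank _ Vtx.Adj' graphG'_adj_iff Vtx.white' Vtx.forcer'
    Vtx.rank' ?_).trans ?_
  · intro w hw
    refine ⟨?_, ?_, fun w' hw' hne hadj => ?_⟩
    · cases w <;> simp [-Fin.val_eq_zero_iff, Vtx.white', Vtx.forcer'] at hw ⊢ <;>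
        (try split_ifs) <;> simp_all [Vtx.Adj', Vtx.Adj, Vtx.InX, Fin.ext_iff, Fin.lt_def,
          -Fin.val_fin_lt, -Fin.val_fin_le, -Fin.val_eq_zero_iff] <;> omega
    · cases w <;> simp [-Fin.val_eq_zero_iff, Vtx.white', Vtx.forcer', Vtx.rank'] at hw ⊢ <;>
        split_ifs <;> simp_all <;> omega
    · cases w <;> simp [-Fin.val_eq_zero_iff, Vtx.white', Vtx.forcer', Vtx.rank'] at hw hadj ⊢ <;>
        (try split_ifs at hadj ⊢) <;> cases w' <;>
        simp_all [Vtx.white', Vtx.Adj', Vtx.Adj, Vtx.InX, Fin.ext_iff, Fin.lt_def,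
          -Fin.val_fin_lt, -Fin.val_fin_le, -Fin.val_eq_zero_iff] <;> (try split_ifs) <;> omega
  -- Here `(q + 2) + 1 + 1 + q + 1 = 2q + 5` vertices are white, one more than for `graphG`.
  · rw [Vtx.sum_eq]
    have := sum_fin_eq_right (⟨0, hq⟩ : Fin q)
    simp only [Fin.ext_iff] at this
    simp [Vtx.white', -Finset.sum_boole, this]
    omega

end UpperBound

/-! ### Forcing processes, time reversal, and bounds on `A` and `C`. -/

section States

variable {q : ℕ}

/-- The blue vertex `u` has not forced yet and can force `v`, where `X` is the set of the vertices
that have forced and `Y` is the set of the white vertices. The condition is invariant under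
reversing time. -/
structure CanForce (X Y : Finset (Vtx q)) (u v : Vtx q) : Prop where
  u_notMem_left : u ∉ X
  u_notMem_right : u ∉ Y
  v_notMem_left : v ∉ X
  v_mem_right : v ∈ Y
  adj : Vtx.Adj u v
  eq_of_adj : ∀ w ∈ Y, Vtx.Adj u w → w = v
  not_adj : ∀ x ∈ X, ¬ Vtx.Adj v x

/-- The force of `v` by `u` leads from the state `s` to the state `s'`. -/
def Step (s s' : Finset (Vtx q) × Finset (Vtx q)) : Prop :=
  ∃ u v, CanForce s.1 s.2 u v ∧ s' = (insert u s.1, s.2.erase v)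

/-- The state `(X, Y)` occurs in a complete forcing process. -/
def Live (X Y : Finset (Vtx q)) : Prop :=
  (∃ W, Relation.ReflTransGen Step (∅, W) (X, Y)) ∧
    ∃ U, Relation.ReflTransGen Step (X, Y) (U, ∅)

lemma CanForce.ne {X Y : Finset (Vtx q)} {u v : Vtx q} (h : CanForce X Y u v) : u ≠ v :=
  fun e => Vtx.adj_irrefl v (e ▸ h.adj)

lemma CanForce.elim_of_two {X Y : Finset (Vtx q)} {u v : Vtx q} (h : CanForce X Y u v)
    {w w' : Vtx q} (hw : w ∈ Y) (hw' : w' ∈ Y) (hne : w ≠ w') (ha : Vtx.Adj u w)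
    (ha' : Vtx.Adj u w') : False :=
  hne ((h.eq_of_adj w hw ha).trans (h.eq_of_adj w' hw' ha').symm)

/-- The conditions `eq_of_adj` and `not_adj` exchange roles: `u` is the only neighbor of `v` in
`insert u X`, because `v` has none in `X`. -/
lemma CanForce.reverse {X Y : Finset (Vtx q)} {u v : Vtx q} (h : CanForce X Y u v) :
    CanForce (Y.erase v) (insert u X) v u where
  u_notMem_left := by simp
  u_notMem_right := by simp [h.v_notMem_left, h.ne.symm]
  v_notMem_left := by simp [h.u_notMem_right]
  v_mem_right := by simp
  adj := h.adj.symm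
  eq_of_adj w hw ha := by
    rcases Finset.mem_insert.1 hw with rfl | hw
    · rfl
    · exact absurd ha (h.not_adj w hw)
  not_adj w hw ha := by
    rw [Finset.mem_erase] at hw
    exact hw.1 (h.eq_of_adj w hw.2 ha)

lemma Step.reverse {s s' : Finset (Vtx q) × Finset (Vtx q)} (h : Step s s') :
    Step s'.swap s.swap := by
  obtain ⟨u, v, h, rfl⟩ := h
  refine ⟨v, u, h.reverse, ?_⟩
  simp [Prod.swap, Finset.insert_erase h.v_mem_right, Finset.erase_insert h.u_notMem_left]

lemma reflTransGen_step_reverse {s s' : Finset (Vtx q) × Finset (Vtx q)}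
    (h : Relation.ReflTransGen Step s s') : Relation.ReflTransGen Step s'.swap s.swap := by
  induction h with
  | refl => exact .refl
  | tail _ h ih => exact .head h.reverse ih

lemma Live.reverse {X Y : Finset (Vtx q)} (h : Live X Y) : Live Y X :=
  ⟨h.2.imp fun _ h => reflTransGen_step_reverse h,
    h.1.imp fun _ h => reflTransGen_step_reverse h⟩

/-- There are no edges between `X` and `Y`, and the sets are disjoint. -/
def Hole (X Y : Finset (Vtx q)) : Prop := ∀ x ∈ X, ∀ y ∈ Y, x ≠ y ∧ ¬ Vtx.Adj x y

lemma Hole.reverse {X Y : Finset (Vtx q)} (h : Hole X Y) : Hole Y X :=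
  fun y hy x hx => ⟨(h x hx y hy).1.symm, fun ha => (h x hx y hy).2 ha.symm⟩

lemma Hole.step {X Y : Finset (Vtx q)} (h : Hole X Y) {u v : Vtx q} (hf : CanForce X Y u v) :
    Hole (insert u X) (Y.erase v) := by
  intro x hx y hy
  rw [Finset.mem_erase] at hy
  rcases Finset.mem_insert.1 hx with rfl | hx
  · exact ⟨fun e => hf.u_notMem_right (e ▸ hy.2), fun ha => hy.1 (hf.eq_of_adj y hy.2 ha)⟩
  · exact h x hx y hy.2

lemma Live.hole {X Y : Finset (Vtx q)} (h : Live X Y) : Hole X Y := by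
  obtain ⟨W, h⟩ := h.1
  suffices H : ∀ s : Finset (Vtx q) × Finset (Vtx q), Relation.ReflTransGen Step (∅, W) s →
      Hole s.1 s.2 from H _ h
  intro s hs
  induction hs with
  | refl => intro x hx; simp at hx
  | tail _ h ih =>
    obtain ⟨u, v, h, rfl⟩ := h
    exact ih.step h

/-- A property that persists until the end, and excludes that all vertices are blue, never holds
in a complete forcing process. -/
lemma Live.not_of_jam (J : Finset (Vtx q) → Finset (Vtx q) → Prop)
    (hne : ∀ X Y, J X Y → Y.Nonempty)
    (hstep : ∀ X Y u v, J X Y → CanForce X Y u v → J (insert u X) (Y.erase v))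
    {X Y : Finset (Vtx q)} (h : Live X Y) : ¬ J X Y := by
  intro hJ
  obtain ⟨U, h⟩ := h.2
  suffices H : ∀ s : Finset (Vtx q) × Finset (Vtx q), Relation.ReflTransGen Step (X, Y) s →
      J s.1 s.2 from by simpa using hne _ _ (H _ h)
  intro s hs
  induction hs with
  | refl => exact hJ
  | tail _ h ih =>
    obtain ⟨u, v, h, rfl⟩ := h
    exact hstep _ _ _ _ ih h

/-- The indicator function of a set. -/
def chi (X : Finset (Vtx q)) (x : Vtx q) : ℕ := if x ∈ X then 1 else 0

lemma chi_le_one (X : Finset (Vtx q)) (x : Vtx q) : chi X x ≤ 1 := by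
  unfold chi; split_ifs <;> simp

lemma chi_eq_one {X : Finset (Vtx q)} {x : Vtx q} : chi X x = 1 ↔ x ∈ X := by
  simp [chi]

lemma chi_eq_zero {X : Finset (Vtx q)} {x : Vtx q} : chi X x = 0 ↔ x ∉ X := by
  simp [chi]

lemma chi_add_le_one {X Y : Finset (Vtx q)} {x y : Vtx q} (h : x ∈ X → y ∈ Y → False) :
    chi X x + chi Y y ≤ 1 := by
  unfold chi; split_ifs with h1 h2 <;> first | exact (h h1 h2).elim | simp

/-- The indices of the vertices `a i` in a set. -/
def aSet (X : Finset (Vtx q)) : Finset (Fin (q + 2)) := Finset.univ.filter (fun i => .a i ∈ X)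

/-- The indices of the vertices `c i` in a set. -/
def cSet (X : Finset (Vtx q)) : Finset (Fin q) := Finset.univ.filter (fun i => .c i ∈ X)

/-- The number of vertices `a i` in a set. -/
def nA (X : Finset (Vtx q)) : ℕ := (aSet X).card

/-- The number of vertices `c i` in a set. -/
def nC (X : Finset (Vtx q)) : ℕ := (cSet X).card

/-- The number of vertices with index `t`, other than `a` and `c`, in a set. -/
def slice (X : Finset (Vtx q)) (t : Fin q) : ℕ :=
  chi X (.Q t) + chi X (.L t) + chi X (.R t) + chi X (.b t)

/-- The number of vertices in a set that belong to no slice, other than the vertices `c i`. -/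
def base (X : Finset (Vtx q)) : ℕ :=
  nA X + chi X .Lk + chi X .Rk + chi X .bk + chi X .b0

lemma card_eq (X : Finset (Vtx q)) : X.card = ∑ t, slice X t + base X + nC X := by
  have h : X.card = ∑ v, chi X v := by simp [chi]
  have hA : nA X = ∑ i, chi X (.a i) := by
    rw [nA, aSet, Finset.card_filter]; rfl
  have hC : nC X = ∑ i, chi X (.c i) := by
    rw [nC, cSet, Finset.card_filter]; rfl
  rw [h, Vtx.sum_eq, base, hA, hC]
  simp only [slice, Finset.sum_add_distrib]
  ring

lemma nA_pos {X : Finset (Vtx q)} (h : 1 ≤ nA X) : ∃ i, .a i ∈ X := by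
  obtain ⟨i, hi⟩ := Finset.card_pos.1 h
  exact ⟨i, by simpa [aSet] using hi⟩

lemma nA_two {X : Finset (Vtx q)} (h : 2 ≤ nA X) : ∃ i j, .a i ∈ X ∧ .a j ∈ X ∧ i ≠ j := by
  obtain ⟨i, hi, j, hj, hij⟩ := Finset.one_lt_card.1 h
  exact ⟨i, j, by simpa [aSet] using hi, by simpa [aSet] using hj, hij⟩

lemma nC_pos {X : Finset (Vtx q)} (h : 1 ≤ nC X) : ∃ i, .c i ∈ X := by
  obtain ⟨i, hi⟩ := Finset.card_pos.1 h
  exact ⟨i, by simpa [cSet] using hi⟩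

lemma nC_pos_of_mem {X : Finset (Vtx q)} {i : Fin q} (h : .c i ∈ X) : 1 ≤ nC X :=
  Finset.card_pos.2 ⟨i, by simpa [cSet] using h⟩

lemma nA_erase {X : Finset (Vtx q)} {v : Vtx q} (h : ∀ i, v ≠ .a i) : nA (X.erase v) = nA X := by
  simp [nA, aSet, fun i => (h i).symm]

lemma nC_erase {X : Finset (Vtx q)} {v : Vtx q} (h : ∀ i, v ≠ .c i) : nC (X.erase v) = nC X := by
  simp [nC, cSet, fun i => (h i).symm]

lemma nC_insert {X : Finset (Vtx q)} {v : Vtx q} (h : ∀ i, v ≠ .c i) : nC (insert v X) = nC X := by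
  simp [nC, cSet, fun i => (h i).symm]

lemma nA_le_nA_erase_add_one (X : Finset (Vtx q)) (v : Vtx q) : nA X ≤ nA (X.erase v) + 1 := by
  by_cases h : ∀ i, v ≠ .a i
  · rw [nA_erase h]; omega
  · push Not at h
    obtain ⟨i, rfl⟩ := h
    have : aSet (X.erase (.a i)) = (aSet X).erase i := by
      ext j; simp [aSet]
    rw [nA, nA, this]
    have := Finset.pred_card_le_card_erase (s := aSet X) (a := i)
    omega

/-- The vertices `b_i`. -/
def Vtx.IsB : Vtx q → Prop
  | .b _ => True
  | .bk => True
  | .b0 => True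
  | _ => False

/-- Between the `a_i` and the `b_j` only a perfect matching is missing; this lemma and `adj_a_of_ne`
use the two sides of that. -/
lemma adj_a_of_isB {β : Vtx q} (h : β.IsB) {i j : Fin (q + 2)} (hij : i ≠ j) :
    Vtx.Adj (.a i) β ∨ Vtx.Adj (.a j) β := by
  rw [Ne, Fin.ext_iff] at hij
  cases β <;> simp only [Vtx.IsB] at h <;> simp only [Vtx.Adj] <;> omega

lemma adj_a_of_ne {β β' : Vtx q} (h : β.IsB) (h' : β'.IsB) (hne : β ≠ β') (i : Fin (q + 2)) :
    Vtx.Adj (.a i) β ∨ Vtx.Adj (.a i) β' := by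
  cases β <;> cases β' <;> simp only [Vtx.IsB] at h h' <;>
    simp only [ne_eq, not_true_eq_false, not_false_eq_true, Vtx.b.injEq, Fin.ext_iff,
      reduceCtorEq] at hne <;> simp only [Vtx.Adj] <;> omega

lemma exists_adj_a {Y : Finset (Vtx q)} (h : 2 ≤ nA Y) {β : Vtx q} (hβ : β.IsB) :
    ∃ i, .a i ∈ Y ∧ Vtx.Adj (.a i) β := by
  obtain ⟨i, j, hi, hj, hij⟩ := nA_two h
  rcases adj_a_of_isB hβ hij with h | h
  · exact ⟨i, hi, h⟩
  · exact ⟨j, hj, h⟩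

/-- Three white vertices of `A` stay white forever: any forcer of one of them is some `a` or some
`b`, misses at most one vertex of `A` other than itself, and so has a second white neighbor in `A`.
-/
lemma Live.nA_right_le {X Y : Finset (Vtx q)} (h : Live X Y) : nA Y ≤ 2 := by
  by_contra hn
  refine h.not_of_jam (fun _ Y => 3 ≤ nA Y) (fun X Y h => ?_) (fun X Y u v h hf => ?_) (by omega)
  · obtain ⟨i, hi⟩ := nA_pos (by omega : 1 ≤ nA Y)
    exact ⟨_, hi⟩
  by_cases hv : ∀ i, v ≠ .a i
  · rwa [nA_erase hv]
  exfalso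
  push Not at hv
  obtain ⟨l, rfl⟩ := hv
  have hu : u.IsB ∨ ∃ i, u = .a i := by
    have := hf.adj
    cases u <;> simp_all [Vtx.Adj, Vtx.IsB]
  rcases hu with hu | ⟨i, rfl⟩
  · have h2 : 2 ≤ nA (Y.erase (.a l)) := by
      have := nA_le_nA_erase_add_one Y (.a l); omega
    obtain ⟨j, hj, hadj⟩ := exists_adj_a h2 hu
    rw [Finset.mem_erase] at hj
    exact hf.elim_of_two hj.2 hf.v_mem_right hj.1 hadj.symm hf.adj
  · obtain ⟨j, j', hj, hj', hne⟩ := nA_two (by omega : 2 ≤ nA Y)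
    refine hf.elim_of_two hj hj' (by simpa using hne) ?_ ?_ <;> rintro rfl
    · exact hf.u_notMem_right hj
    · exact hf.u_notMem_right hj'

lemma Live.nA_left_le {X Y : Finset (Vtx q)} (h : Live X Y) : nA X ≤ 2 := h.reverse.nA_right_le

/-- The vertices of `C` are twins, so a neighbor of one of two white ones sees both. -/
lemma Live.nC_right_le {X Y : Finset (Vtx q)} (h : Live X Y) : nC Y ≤ 1 := by
  by_contra hn
  refine h.not_of_jam (fun _ Y => 2 ≤ nC Y) (fun X Y h => ?_) (fun X Y u v h hf => ?_) (by omega)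
  · obtain ⟨i, hi⟩ := nC_pos (by omega : 1 ≤ nC Y)
    exact ⟨_, hi⟩
  by_cases hv : ∀ i, v ≠ .c i
  · rwa [nC_erase hv]
  exfalso
  push Not at hv
  obtain ⟨l, rfl⟩ := hv
  obtain ⟨i, hi, j, hj, hij⟩ := Finset.one_lt_card.1 h
  refine hf.elim_of_two (w := .c i) (w' := .c j) (by simpa [cSet] using hi)
    (by simpa [cSet] using hj) (by simpa using hij) ?_ ?_ <;>
  · have := hf.adj
    cases u <;> simp_all [Vtx.Adj]

lemma Live.nC_left_le {X Y : Finset (Vtx q)} (h : Live X Y) : nC X ≤ 1 := h.reverse.nC_right_le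

end States

/-! ### Configurations from which the process cannot finish. -/

section Jams

variable {q : ℕ}

/-- A stuck configuration: the only possible forces into `B` are those of `b t` by `L t` and of
`b0` by `Rk`. -/
structure StuckL (X Y : Finset (Vtx q)) : Prop where
  Q_mem : ∀ t, .Q t ∈ Y
  bk_mem : .bk ∈ Y
  two_le : 2 ≤ nA Y
  L_or_b : ∀ t, .L t ∈ X ∨ .b t ∈ Y
  Rk_or_b0 : .Rk ∈ X ∨ .b0 ∈ Y

/-- A vertex `L t` or `Rk` can only force its own `b t` or `b0`, and then takes over its place in
the alternative. A vertex of `C` only forces vertices whose whiteness is not required. All others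
see two white vertices or cannot act. -/
lemma StuckL.step (hq : 0 < q) {X Y : Finset (Vtx q)} {u v : Vtx q} (h : StuckL X Y)
    (hf : CanForce X Y u v) : StuckL (insert u X) (Y.erase v) := by
  have hQ := h.Q_mem
  cases u with
  | Q t => exact (hf.u_notMem_right (hQ t)).elim
  | L t =>
    have hb : .b t ∈ Y := (h.L_or_b t).resolve_left hf.u_notMem_left
    obtain rfl : .b t = v := hf.eq_of_adj _ hb rfl
    refine ⟨fun s => by simp [hQ s], by simp [h.bk_mem], by
      rw [nA_erase (by simp)]; exact h.two_le, fun s => ?_, ?_⟩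
    · by_cases hs : s = t
      · simp [hs]
      · simpa [hs] using h.L_or_b s
    · simpa using h.Rk_or_b0
  | R t =>
    exact (hf.elim_of_two (hQ t) h.bk_mem (by simp) (le_refl t) trivial).elim
  | Lk => exact (hf.elim_of_two (hQ ⟨0, hq⟩) h.bk_mem (by simp) trivial trivial).elim
  | Rk =>
    have hb : .b0 ∈ Y := h.Rk_or_b0.resolve_left hf.u_notMem_left
    obtain rfl : .b0 = v := hf.eq_of_adj _ hb trivial
    exact ⟨fun s => by simp [hQ s], by simp [h.bk_mem], by
      rw [nA_erase (by simp)]; exact h.two_le, fun s => by simpa using h.L_or_b s, by simp⟩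
  | b t =>
    obtain ⟨i, hi, ha⟩ := exists_adj_a h.two_le (β := .b t) trivial
    exact (hf.elim_of_two (hQ t) hi (by simp) trivial ha.symm).elim
  | b0 =>
    obtain ⟨i, hi, ha⟩ := exists_adj_a h.two_le (β := .b0) trivial
    exact (hf.elim_of_two (hQ ⟨0, hq⟩) hi (by simp) trivial ha.symm).elim
  | bk => exact (hf.u_notMem_right h.bk_mem).elim
  | a i =>
    obtain ⟨j, j', hj, hj', hne⟩ := nA_two h.two_le
    exact (hf.elim_of_two hj hj' (by simpa using hne)
      (fun e => hf.u_notMem_right (e ▸ hj)) (fun e => hf.u_notMem_right (e ▸ hj'))).elim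
  | c t =>
    have hadj := hf.adj
    have hA : nA (Y.erase v) = nA Y := nA_erase (by rintro i rfl; exact hadj)
    have hne : ∀ w, v ≠ w → w ∈ Y → w ∈ Y.erase v := fun w hw hm =>
      Finset.mem_erase.2 ⟨hw.symm, hm⟩
    refine ⟨fun s => hne _ ?_ (hQ s), hne _ ?_ h.bk_mem, hA ▸ h.two_le, fun s => ?_, ?_⟩
    · rintro rfl; exact hadj
    · rintro rfl; exact hadj
    · exact (h.L_or_b s).imp (fun h => Finset.mem_insert_of_mem h)
        (hne _ (by rintro rfl; exact hadj))
    · exact h.Rk_or_b0.imp (fun h => Finset.mem_insert_of_mem h)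
        (hne _ (by rintro rfl; exact hadj))

lemma Live.not_stuckL (hq : 0 < q) {X Y : Finset (Vtx q)} (h : Live X Y) : ¬ StuckL X Y :=
  h.not_of_jam StuckL (fun _ _ h => ⟨_, h.bk_mem⟩) (fun _ _ _ _ h hf => h.step hq hf)

/-- The vertices `b_i` and `Q t`. -/
def Vtx.IsBQ : Vtx q → Prop
  | .b _ => True
  | .bk => True
  | .b0 => True
  | .Q _ => True
  | _ => False

/-- A stuck configuration in which a vertex of `C` and all vertices `b_i`, `Q t` are white, except
that `bk` may have forced already. -/
structure StuckAll (X Y : Finset (Vtx q)) : Prop where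
  c_mem : ∃ t, .c t ∈ Y
  Q_mem : ∀ t, .Q t ∈ Y
  b_mem : ∀ t, .b t ∈ Y
  b0_mem : .b0 ∈ Y
  bk_mem : .bk ∈ X ∨ .bk ∈ Y
  one_le : 1 ≤ nA Y

/-- Only vertices of `C` can force here, and their neighbors `L`, `R`, `Lk`, `Rk` do not occur in
the configuration. -/
lemma StuckAll.step (hq : 0 < q) {X Y : Finset (Vtx q)} {u v : Vtx q} (h : StuckAll X Y)
    (hf : CanForce X Y u v) : StuckAll (insert u X) (Y.erase v) := by
  obtain ⟨s, hs⟩ := h.c_mem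
  have hQ := h.Q_mem
  cases u with
  | Q t => exact (hf.u_notMem_right (hQ t)).elim
  | b t => exact (hf.u_notMem_right (h.b_mem t)).elim
  | b0 => exact (hf.u_notMem_right h.b0_mem).elim
  | bk => exact (h.bk_mem.elim hf.u_notMem_left hf.u_notMem_right).elim
  | L t => exact (hf.elim_of_two hs (h.b_mem t) (by simp) trivial rfl).elim
  | R t => exact (hf.elim_of_two hs (hQ t) (by simp) trivial (le_refl t)).elim
  | Lk => exact (hf.elim_of_two hs (hQ ⟨0, hq⟩) (by simp) trivial trivial).elim
  | Rk => exact (hf.elim_of_two hs h.b0_mem (by simp) trivial trivial).elim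
  | a i =>
    obtain ⟨j, hj⟩ := nA_pos h.one_le
    have hij : Vtx.Adj (.a i) (.a j) := fun e => hf.u_notMem_right (e ▸ hj)
    rcases adj_a_of_ne (β := .b0) (β' := .b ⟨0, hq⟩) trivial trivial (by simp) i with ha | ha
    · exact (hf.elim_of_two hj h.b0_mem (by simp) hij ha).elim
    · exact (hf.elim_of_two hj (h.b_mem _) (by simp) hij ha).elim
  | c t =>
    have hadj := hf.adj
    have hA : nA (Y.erase v) = nA Y := nA_erase (by rintro i rfl; exact hadj)
    have hne : ∀ w, v ≠ w → w ∈ Y → w ∈ Y.erase v := fun w hw hm =>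
      Finset.mem_erase.2 ⟨hw.symm, hm⟩
    refine ⟨⟨s, hne _ ?_ hs⟩, fun s => hne _ ?_ (hQ s), fun s => hne _ ?_ (h.b_mem s),
      hne _ ?_ h.b0_mem, h.bk_mem.imp (fun h => Finset.mem_insert_of_mem h) (hne _ ?_),
      hA ▸ h.one_le⟩ <;>
    · rintro rfl; exact hadj

/-- A stuck configuration in which a vertex of `C`, two vertices of `A` and all but at most one
of the vertices `b_i`, `Q t` are white. -/
structure StuckMost (X Y : Finset (Vtx q)) : Prop where
  c_mem : ∃ t, .c t ∈ Y
  eq_of_notMem : ∀ x y : Vtx q, x.IsBQ → y.IsBQ → x ∉ Y → y ∉ Y → x = y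
  two_le : 2 ≤ nA Y

lemma StuckMost.mem_of_notMem {X Y : Finset (Vtx q)} (h : StuckMost X Y) {x y : Vtx q}
    (hx : x.IsBQ) (hxY : x ∉ Y) (hy : y.IsBQ) (hne : x ≠ y) : y ∈ Y := by
  by_contra hyY
  exact hne (h.eq_of_notMem x y hx hy hxY hyY)

/-- The one exception among the `b_i` and `Q t` allows two kinds of escape, both into another jam:
`bk` forces a vertex of `A`, giving `StuckAll`, or the `L t` or `Rk` next to the exceptional `b t`
or `b0` forces the white vertex of `C`, giving `StuckL`. -/
lemma StuckMost.step (hq : 0 < q) {X Y : Finset (Vtx q)} {u v : Vtx q} (h : StuckMost X Y)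
    (hf : CanForce X Y u v) : StuckL (insert u X) (Y.erase v) ∨
      StuckAll (insert u X) (Y.erase v) ∨ StuckMost (insert u X) (Y.erase v) := by
  obtain ⟨s, hs⟩ := h.c_mem
  cases u with
  | Q t =>
    have H := fun y hy hne => h.mem_of_notMem (x := .Q t) (y := y) trivial hf.u_notMem_right hy hne
    exact (hf.elim_of_two (H .b0 trivial (by simp)) (H (.b t) trivial (by simp)) (by simp)
      trivial trivial).elim
  | b t =>
    obtain ⟨i, hi, ha⟩ := exists_adj_a h.two_le (β := .b t) trivial
    have H := fun y hy hne => h.mem_of_notMem (x := .b t) (y := y) trivial hf.u_notMem_right hy hne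
    exact (hf.elim_of_two (H (.Q t) trivial (by simp)) hi (by simp) trivial ha.symm).elim
  | b0 =>
    obtain ⟨i, hi, ha⟩ := exists_adj_a h.two_le (β := .b0) trivial
    have H := fun y hy hne => h.mem_of_notMem (x := .b0) (y := y) trivial hf.u_notMem_right hy hne
    exact (hf.elim_of_two (H (.Q ⟨0, hq⟩) trivial (by simp)) hi (by simp) trivial ha.symm).elim
  | bk =>
    obtain ⟨i, hi, ha⟩ := exists_adj_a h.two_le (β := .bk) trivial
    have H := fun y hy hne => h.mem_of_notMem (x := .bk) (y := y) trivial hf.u_notMem_right hy hne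
    obtain rfl := hf.eq_of_adj _ hi ha.symm
    refine Or.inr (Or.inl ⟨⟨s, by simpa using hs⟩,
      fun t => by simpa using H (.Q t) trivial (by simp),
      fun t => by simpa using H (.b t) trivial (by simp),
      by simpa using H .b0 trivial (by simp), Or.inl (by simp), ?_⟩)
    have := nA_le_nA_erase_add_one Y (.a i)
    have := h.two_le
    omega
  | a i =>
    obtain ⟨j, j', hj, hj', hne⟩ := nA_two h.two_le
    exact (hf.elim_of_two hj hj' (by simpa using hne)
      (fun e => hf.u_notMem_right (e ▸ hj)) (fun e => hf.u_notMem_right (e ▸ hj'))).elim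
  | L t =>
    obtain rfl := hf.eq_of_adj _ hs trivial
    have hb : .b t ∉ Y := fun hb => hf.elim_of_two hs hb (by simp) trivial rfl
    have H := fun y hy hne => h.mem_of_notMem (x := .b t) (y := y) trivial hb hy hne
    refine Or.inl ⟨fun t => by simpa using H (.Q t) trivial (by simp),
      by simpa using H .bk trivial (by simp), by rw [nA_erase (by simp)]; exact h.two_le,
      fun t' => ?_, Or.inr (by simpa using H .b0 trivial (by simp))⟩
    by_cases ht : t' = t
    · simp [ht]
    · exact Or.inr (by simpa using H (.b t') trivial (by simpa [eq_comm] using ht))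
  | R t =>
    have hb : .bk ∉ Y := fun hb => hf.elim_of_two hs hb (by simp) trivial trivial
    have := h.mem_of_notMem (x := .bk) (y := .Q t) trivial hb trivial (by simp)
    exact (hf.elim_of_two hs this (by simp) trivial (le_refl t)).elim
  | Lk =>
    have hb : .bk ∉ Y := fun hb => hf.elim_of_two hs hb (by simp) trivial trivial
    have := h.mem_of_notMem (x := .bk) (y := .Q ⟨0, hq⟩) trivial hb trivial (by simp)
    exact (hf.elim_of_two hs this (by simp) trivial trivial).elim
  | Rk =>
    obtain rfl := hf.eq_of_adj _ hs trivial
    have hb : .b0 ∉ Y := fun hb => hf.elim_of_two hs hb (by simp) trivial trivial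
    have H := fun y hy hne => h.mem_of_notMem (x := .b0) (y := y) trivial hb hy hne
    exact Or.inl ⟨fun t => by simpa using H (.Q t) trivial (by simp),
      by simpa using H .bk trivial (by simp), by rw [nA_erase (by simp)]; exact h.two_le,
      fun t => Or.inr (by simpa using H (.b t) trivial (by simp)), by simp⟩
  | c t =>
    have hadj := hf.adj
    refine Or.inr (Or.inr ⟨⟨s, ?_⟩, fun x y hx hy hxY hyY => ?_, ?_⟩)
    · exact Finset.mem_erase.2 ⟨by rintro rfl; exact hadj, hs⟩
    · have hv : ¬ v.IsBQ := fun hv => by cases v <;> first | exact hadj | exact hv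
      rw [Finset.mem_erase, not_and] at hxY hyY
      exact h.eq_of_notMem x y hx hy (hxY fun e => hv (e ▸ hx)) (hyY fun e => hv (e ▸ hy))
    · rw [nA_erase (by rintro i rfl; exact hadj)]; exact h.two_le

lemma Live.not_stuckAll_or_stuckMost (hq : 0 < q) {X Y : Finset (Vtx q)} (h : Live X Y) :
    ¬ (StuckAll X Y ∨ StuckMost X Y) := by
  intro hs
  refine h.not_of_jam (fun X Y => StuckL X Y ∨ StuckAll X Y ∨ StuckMost X Y) ?_ ?_ (Or.inr hs)
  · rintro X Y (h | h | h)
    · exact ⟨_, h.bk_mem⟩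
    · exact ⟨_, h.b0_mem⟩
    · exact ⟨_, h.c_mem.choose_spec⟩
  · rintro X Y u v (h | h | h) hf
    · exact Or.inl (h.step hq hf)
    · exact Or.inr (Or.inl (h.step hq hf))
    · exact h.step hq hf

end Jams

/-! ### Size bounds for pairs of sets with no edge, or a single edge, between them. -/

section Holes

variable {q : ℕ}

/-- There are no edges from the vertices `a i` in `X` to `Y`, nor common vertices of this kind. -/
def SepA (X Y : Finset (Vtx q)) : Prop :=
  ∀ i, .a i ∈ X → ∀ y ∈ Y, .a i ≠ y ∧ ¬ Vtx.Adj (.a i) y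

lemma Hole.sepA {X Y : Finset (Vtx q)} (h : Hole X Y) : SepA X Y := fun _ hi => h _ hi

lemma SepA.nA_eq_zero {X Y : Finset (Vtx q)} (h : SepA X Y) (hX : 1 ≤ nA X) : nA Y = 0 := by
  by_contra hY
  obtain ⟨i, hi⟩ := nA_pos hX
  obtain ⟨j, hj⟩ := nA_pos (Nat.one_le_iff_ne_zero.2 hY)
  obtain ⟨h1, h2⟩ := h i hi _ hj
  exact h2 fun e => h1 (by rw [e])

lemma SepA.chi_eq_zero {X Y : Finset (Vtx q)} (h : SepA X Y) (hX : 2 ≤ nA X) {β : Vtx q}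
    (hβ : β.IsB) : chi Y β = 0 := by
  obtain ⟨i, hi, ha⟩ := exists_adj_a hX hβ
  exact RegularCospectral.chi_eq_zero.2 fun hb => (h i hi _ hb).2 ha

lemma SepA.nA_le_one {X Y : Finset (Vtx q)} (h : SepA X Y) {β : Vtx q} (hβ : β.IsB)
    (hY : 1 ≤ chi Y β) : nA X ≤ 1 := by
  by_contra hX
  have := h.chi_eq_zero (by omega) hβ
  omega

lemma SepA.chi_add_chi_le {X Y : Finset (Vtx q)} (h : SepA X Y) (hX : 1 ≤ nA X) {β β' : Vtx q}
    (hβ : β.IsB) (hβ' : β'.IsB) (hne : β ≠ β') : chi Y β + chi Y β' ≤ 1 := by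
  obtain ⟨i, hi⟩ := nA_pos hX
  refine chi_add_le_one fun h1 h2 => ?_
  rcases adj_a_of_ne hβ hβ' hne i with ha | ha
  · exact (h i hi _ h1).2 ha
  · exact (h i hi _ h2).2 ha

lemma Hole.chi_le {X Y : Finset (Vtx q)} (h : Hole X Y) {x y : Vtx q} (ha : Vtx.Adj x y) :
    chi X x + chi Y y ≤ 1 := chi_add_le_one fun hx hy => (h x hx y hy).2 ha

lemma Hole.chi_self_le {X Y : Finset (Vtx q)} (h : Hole X Y) (x : Vtx q) :
    chi X x + chi Y x ≤ 1 := chi_add_le_one fun hx hy => (h x hx x hy).1 rfl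

/-- More than half of a slice, or more than two thirds of the base, lie in the set. -/
def Heavy (X : Finset (Vtx q)) : Prop := (∃ t, 3 ≤ slice X t) ∨ 5 ≤ base X

/-- A slice induces the 4-cycle `L R Q b`. If both sides meet it, each does so in one vertex, and
the two are opposite; if only one does, the last two hypotheses give the bound. -/
lemma slice_add_slice_le (Q L R b Q' L' R' b' : ℕ) (_ : Q + Q' ≤ 1) (_ : L + L' ≤ 1)
    (_ : R + R' ≤ 1) (_ : b + b' ≤ 1) (_ : L + R' ≤ 1) (_ : R + L' ≤ 1) (_ : R + Q' ≤ 1)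
    (_ : Q + R' ≤ 1) (_ : Q + b' ≤ 1) (_ : b + Q' ≤ 1) (_ : b + L' ≤ 1) (_ : L + b' ≤ 1)
    (_ : Q + L + R + b ≤ 2) (_ : Q' + L' + R' + b' ≤ 2) :
    Q + L + R + b + (Q' + L' + R' + b') ≤ 2 := by
  rcases Nat.eq_zero_or_pos Q with rfl | hQ
  · rcases Nat.eq_zero_or_pos R with rfl | hR <;> omega
  · omega

lemma Hole.card_add_card_le {X Y : Finset (Vtx q)} (h : Hole X Y) (hX : nA X ≤ 2)
    (hY : nA Y ≤ 2) (hXC : nC X = 0) (hYC : nC Y = 0) (hX' : ¬ Heavy X) (hY' : ¬ Heavy Y) :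
    X.card + Y.card ≤ 2 * q + 4 := by
  simp only [Heavy, not_or, not_exists, not_le] at hX' hY'
  have hs : ∀ t, slice X t + slice Y t ≤ 2 := fun t => by
    have h1 := hX'.1 t
    have h2 := hY'.1 t
    rw [slice] at h1 h2 ⊢
    rw [slice]
    exact slice_add_slice_le _ _ _ _ _ _ _ _ (h.chi_self_le _) (h.chi_self_le _)
      (h.chi_self_le _) (h.chi_self_le _) (h.chi_le (le_refl t)) (h.chi_le (le_refl t))
      (h.chi_le (le_refl t)) (h.chi_le (le_refl t)) (h.chi_le trivial) (h.chi_le trivial)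
      (h.chi_le rfl) (h.chi_le rfl) (by omega) (by omega)
  have hb : base X + base Y ≤ 4 := by
    have h1 := hX'.2
    have h2 := hY'.2
    have := h.chi_self_le .Lk
    have := h.chi_self_le .Rk
    have := h.chi_self_le .bk
    have := h.chi_self_le .b0
    have := h.chi_le (x := .Lk) (y := .Rk) trivial
    have := h.chi_le (x := .Rk) (y := .Lk) trivial
    have := h.chi_le (x := .bk) (y := .Lk) trivial
    have := h.chi_le (x := .Lk) (y := .bk) trivial
    have := h.chi_le (x := .b0) (y := .Rk) trivial
    have := h.chi_le (x := .Rk) (y := .b0) trivial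
    have := h.sepA.nA_eq_zero
    have := h.reverse.sepA.nA_eq_zero
    have := fun hX => h.sepA.chi_add_chi_le hX (β := .bk) (β' := .b0) trivial trivial (by simp)
    have := fun hX => h.reverse.sepA.chi_add_chi_le hX (β := .bk) (β' := .b0) trivial trivial
      (by simp)
    have := fun hX => h.sepA.chi_eq_zero hX (β := .bk) trivial
    have := fun hX => h.sepA.chi_eq_zero hX (β := .b0) trivial
    have := fun hX => h.reverse.sepA.chi_eq_zero hX (β := .bk) trivial
    have := fun hX => h.reverse.sepA.chi_eq_zero hX (β := .b0) trivial
    rw [base] at h1 h2 ⊢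
    rw [base]
    omega
  have : ∑ t, slice X t + ∑ t, slice Y t ≤ 2 * q := by
    rw [← Finset.sum_add_distrib]
    refine (Finset.sum_le_card_nsmul _ _ 2 fun t _ => hs t).trans ?_
    simp [mul_comm]
  rw [card_eq X, card_eq Y]
  omega

/-- The sets are disjoint, and there is at most one edge between them, namely `u v`. -/
def NearHole (X Y : Finset (Vtx q)) (u v : Vtx q) : Prop :=
  ∀ x ∈ X, ∀ y ∈ Y, x ≠ y ∧ (Vtx.Adj x y → x = u ∧ y = v)

lemma NearHole.reverse {X Y : Finset (Vtx q)} {u v : Vtx q} (h : NearHole X Y u v) :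
    NearHole Y X v u :=
  fun y hy x hx => ⟨(h x hx y hy).1.symm, fun ha => ((h x hx y hy).2 ha.symm).symm⟩

lemma NearHole.chi_self_le {X Y : Finset (Vtx q)} {u v : Vtx q} (h : NearHole X Y u v)
    (x : Vtx q) : chi X x + chi Y x ≤ 1 := chi_add_le_one fun hx hy => (h x hx x hy).1 rfl

lemma NearHole.chi_le {X Y : Finset (Vtx q)} {u v : Vtx q} (h : NearHole X Y u v)
    {x y : Vtx q} (ha : Vtx.Adj x y) (hne : x ≠ u ∨ y ≠ v) : chi X x + chi Y y ≤ 1 :=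
  chi_add_le_one fun hx hy => by
    have := (h x hx y hy).2 ha
    tauto

lemma NearHole.two_edges {X Y : Finset (Vtx q)} {u v : Vtx q} (h : NearHole X Y u v)
    {x y x' y' : Vtx q} (ha : Vtx.Adj x y) (ha' : Vtx.Adj x' y') (hne : x ≠ x' ∨ y ≠ y') :
    chi X x + chi Y y + chi X x' + chi Y y' ≤ 3 := by
  have h1 := chi_le_one X x
  have h2 := chi_le_one Y y
  have h3 := chi_le_one X x'
  have h4 := chi_le_one Y y'
  by_contra hn
  have hx := chi_eq_one.1 (by omega : chi X x = 1)
  have hy := chi_eq_one.1 (by omega : chi Y y = 1)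
  have hx' := chi_eq_one.1 (by omega : chi X x' = 1)
  have hy' := chi_eq_one.1 (by omega : chi Y y' = 1)
  have e := (h _ hx _ hy).2 ha
  have e' := (h _ hx' _ hy').2 ha'
  rw [e.1, e.2, e'.1, e'.2] at hne
  simp at hne

/-- Five edges run between slices `i < j`, and four of them meet `Q i` or `Q j`. Each side may omit
only one vertex and at most one edge may survive, so the omitted vertices are `Q i` and `Q j`, and
the surviving edge joins `L i` to `R j`. -/
lemma NearHole.slice_slice_lt {X Y : Finset (Vtx q)} {u v : Vtx q} (h : NearHole X Y u v)
    {i j : Fin q} (hij : i < j) (hi : 3 ≤ slice X i) (hj : 3 ≤ slice Y j) :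
    .Q i ∉ X ∧ .Q j ∉ Y ∧ u = .L i ∧ v = .R j := by
  have a1 : Vtx.Adj (.L i) (.R j) := hij.le
  have a2 : Vtx.Adj (.Q i) (.L j) := hij
  have a3 : Vtx.Adj (.R i) (.Q j) := hij.le
  have a4 : Vtx.Adj (.b i) (.Q j) := trivial
  have a5 : Vtx.Adj (.Q i) (.b j) := trivial
  have := h.two_edges a1 a2 (by simp)
  have := h.two_edges a1 a3 (by simp)
  have := h.two_edges a1 a4 (by simp)
  have := h.two_edges a1 a5 (by simp)
  have := h.two_edges a2 a3 (by simp)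
  have := h.two_edges a2 a4 (by simp)
  have := h.two_edges a2 a5 (by simp)
  have := h.two_edges a3 a4 (by simp)
  have := h.two_edges a3 a5 (by simp)
  have := h.two_edges a4 a5 (by simp)
  have := chi_le_one X (.Q i)
  have := chi_le_one X (.L i)
  have := chi_le_one X (.R i)
  have := chi_le_one X (.b i)
  have := chi_le_one Y (.Q j)
  have := chi_le_one Y (.L j)
  have := chi_le_one Y (.R j)
  have := chi_le_one Y (.b j)
  rw [slice] at hi hj
  have hQ : chi X (.Q i) = 0 ∧ chi Y (.Q j) = 0 := by omega
  have hL := chi_eq_one.1 (by omega : chi X (.L i) = 1)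
  have hR := chi_eq_one.1 (by omega : chi Y (.R j) = 1)
  have := (h _ hL _ hR).2 a1
  exact ⟨chi_eq_zero.1 hQ.1, chi_eq_zero.1 hQ.2, this.1.symm, this.2.symm⟩

lemma NearHole.slice_slice {X Y : Finset (Vtx q)} {u v : Vtx q} (h : NearHole X Y u v)
    {i j : Fin q} (hi : 3 ≤ slice X i) (hj : 3 ≤ slice Y j) :
    .Q i ∉ X ∧ .Q j ∉ Y ∧ ((i < j ∧ u = .L i ∧ v = .R j) ∨ (j < i ∧ u = .R i ∧ v = .L j)) := by
  rcases lt_trichotomy i j with hij | rfl | hij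
  · obtain ⟨h1, h2, h3, h4⟩ := h.slice_slice_lt hij hi hj
    exact ⟨h1, h2, Or.inl ⟨hij, h3, h4⟩⟩
  · have := h.chi_self_le (.Q i)
    have := h.chi_self_le (.L i)
    have := h.chi_self_le (.R i)
    have := h.chi_self_le (.b i)
    rw [slice] at hi hj
    omega
  · obtain ⟨h1, h2, h3, h4⟩ := h.reverse.slice_slice_lt hij hj hi
    exact ⟨h2, h1, Or.inr ⟨hij, h4, h3⟩⟩

/-- The matching `Rk`–`L j`, `bk`–`R j`, together with `Lk` and `b0` joined to `Q j` and some `a`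
joined to `b j`, leaves at least two edges whichever vertices are omitted. -/
lemma NearHole.base_slice {X Y : Finset (Vtx q)} {u v : Vtx q} (h : NearHole X Y u v)
    (hA : nA X ≤ 2) {j : Fin q} (hX : 5 ≤ base X) (hj : 3 ≤ slice Y j) : False := by
  have a1 : Vtx.Adj .Lk (.Q j) := trivial
  have a2 : Vtx.Adj .Rk (.L j) := trivial
  have a3 : Vtx.Adj .bk (.R j) := trivial
  have a4 : Vtx.Adj .b0 (.Q j) := trivial
  have := h.two_edges a1 a2 (by simp)
  have := h.two_edges a1 a3 (by simp)
  have := h.two_edges a1 a4 (by simp)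
  have := h.two_edges a2 a3 (by simp)
  have := h.two_edges a2 a4 (by simp)
  have := h.two_edges a3 a4 (by simp)
  have := chi_le_one X .Lk
  have := chi_le_one X .Rk
  have := chi_le_one X .bk
  have := chi_le_one X .b0
  have := chi_le_one Y (.Q j)
  have := chi_le_one Y (.L j)
  have := chi_le_one Y (.R j)
  have := chi_le_one Y (.b j)
  rw [slice] at hj
  rw [base] at hX
  by_cases h2 : 2 ≤ nA X
  · obtain ⟨i, hi, ha⟩ := exists_adj_a h2 (β := .b j) trivial
    have := chi_eq_one.2 hi
    have := h.two_edges ha a1 (by simp)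
    have := h.two_edges ha a2 (by simp)
    have := h.two_edges ha a3 (by simp)
    have := h.two_edges ha a4 (by simp)
    omega
  · omega

lemma NearHole.card_add_card_le_of_lt {X Y : Finset (Vtx q)} {i j : Fin q}
    (h : NearHole X Y (.L i) (.R j)) (hX : nA X ≤ 2) (hY : nA Y ≤ 2)
    (hXC : nC X = 0) (hYC : nC Y = 0) (hij : i < j) (hi : 3 ≤ slice X i) (hj : 3 ≤ slice Y j) :
    X.card + Y.card ≤ 2 * q + 5 := by
  obtain ⟨hQi, hQj, -⟩ := h.slice_slice hi hj
  rw [← chi_eq_zero] at hQi hQj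
  -- By `slice_slice`, slice `i` is the only heavy one of `X` and slice `j` the only heavy one of
  -- `Y`; each may contribute one extra.
  have hs : ∀ t, slice X t + slice Y t ≤
      2 + ((if t = i then 1 else 0) + (if t = j then 1 else 0)) := by
    intro t
    have h1 : 3 ≤ slice X t → t = i := fun ht => by
      obtain ⟨-, -, ⟨-, h, -⟩ | ⟨-, h, -⟩⟩ := h.slice_slice ht hj
      · simpa [eq_comm] using h
      · simp at h
    have h2 : 3 ≤ slice Y t → t = j := fun ht => by
      obtain ⟨-, -, ⟨-, -, h⟩ | ⟨-, -, h⟩⟩ := h.slice_slice hi ht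
      · simpa [eq_comm] using h
      · simp at h
    have g1 := h.chi_self_le (.Q t)
    have g2 := h.chi_self_le (.L t)
    have g3 := h.chi_self_le (.R t)
    have g4 := h.chi_self_le (.b t)
    have e2 := h.chi_le (x := .R t) (y := .L t) (le_refl t) (by simp)
    have e3 := h.chi_le (x := .R t) (y := .Q t) (le_refl t) (by simp)
    have e4 := h.chi_le (x := .Q t) (y := .R t) (le_refl t) (by simp)
    have e5 := h.chi_le (x := .Q t) (y := .b t) trivial (by simp)
    have e6 := h.chi_le (x := .b t) (y := .Q t) trivial (by simp)
    have e7 := h.chi_le (x := .b t) (y := .L t) rfl (by simp)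
    have e8 := h.chi_le (x := .L t) (y := .b t) rfl (by simp)
    have e1 := h.chi_le (x := .L t) (y := .R t) (le_refl t) (by
      by_contra hn
      simp only [ne_eq, Vtx.L.injEq, Vtx.R.injEq, not_or, not_not] at hn
      omega)
    have := slice_add_slice_le _ _ _ _ _ _ _ _ g1 g2 g3 g4 e1 e2 e3 e4 e5 e6 e7 e8
    by_cases hti : t = i
    · subst hti
      simp only [if_true, slice] at hi ⊢
      omega
    · by_cases htj : t = j
      · subst htj
        simp only [if_true, slice] at hj ⊢
        omega
      · have := fun h => hti (h1 h)
        have := fun h => htj (h2 h)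
        simp only [slice] at *
        omega
  have hsum : ∑ t, slice X t + ∑ t, slice Y t ≤ 2 * q + 2 := by
    rw [← Finset.sum_add_distrib]
    refine (Finset.sum_le_sum fun t _ => hs t).trans ?_
    simp [Finset.sum_add_distrib, mul_comm]
  -- The heavy slices exclude `Rk` and `bk` from both sides and leave at most one vertex of `A` in
  -- total; `Lk` and `b0` add at most one each.
  have hb : base X + base Y ≤ 3 := by
    have sX : SepA X Y := fun s hs y hy => ⟨(h _ hs _ hy).1, fun ha => by
      simpa using ((h _ hs _ hy).2 ha).1⟩
    have sY : SepA Y X := fun s hs y hy => ⟨(h.reverse _ hs _ hy).1, fun ha => by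
      simpa using ((h.reverse _ hs _ hy).2 ha).1⟩
    have := chi_le_one X (.L i)
    have := chi_le_one X (.R i)
    have := chi_le_one X (.b i)
    have := chi_le_one Y (.L j)
    have := chi_le_one Y (.R j)
    have := chi_le_one Y (.b j)
    have := h.chi_le (x := .L i) (y := .Rk) trivial (by simp)
    have := h.chi_le (x := .R i) (y := .bk) trivial (by simp)
    have := h.chi_le (x := .Rk) (y := .L j) trivial (by simp)
    have := h.chi_le (x := .bk) (y := .R j) trivial (by simp)
    have := sX.nA_le_one (β := .b j) trivial
    have := sY.nA_le_one (β := .b i) trivial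
    have := sX.nA_eq_zero
    have := h.chi_self_le .Lk
    have := h.chi_self_le .b0
    rw [slice] at hi hj
    rw [base, base]
    omega
  rw [card_eq X, card_eq Y]
  omega

lemma NearHole.card_add_card_le {X Y : Finset (Vtx q)} {u v : Vtx q}
    (h : NearHole X Y u v) (hX : nA X ≤ 2) (hY : nA Y ≤ 2) (hXC : nC X = 0) (hYC : nC Y = 0)
    (hX' : Heavy X) (hY' : Heavy Y) : X.card + Y.card ≤ 2 * q + 5 := by
  rcases hX' with ⟨i, hi⟩ | hX' <;> rcases hY' with ⟨j, hj⟩ | hY'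
  · obtain ⟨-, -, ⟨hij, rfl, rfl⟩ | ⟨hij, rfl, rfl⟩⟩ := h.slice_slice hi hj
    · exact h.card_add_card_le_of_lt hX hY hXC hYC hij hi hj
    · rw [add_comm]
      exact h.reverse.card_add_card_le_of_lt hY hX hYC hXC hij hj hi
  · exact (h.reverse.base_slice hY hY' hi).elim
  · exact (h.base_slice hX hX' hj).elim
  · have := h.chi_self_le .Lk
    have := h.chi_self_le .Rk
    have := h.chi_self_le .bk
    have := h.chi_self_le .b0
    rw [base] at hX' hY'
    omega

end Holes

/-! ### The invariant `Early` and the lower bound on `Z(G)`. -/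

section Invariant

variable {q : ℕ}

lemma CanForce.chi_add_chi_le {X Y : Finset (Vtx q)} {u v : Vtx q} (hf : CanForce X Y u v)
    {w w' : Vtx q} (ha : Vtx.Adj u w) (ha' : Vtx.Adj u w') (hne : w ≠ w') :
    chi Y w + chi Y w' ≤ 1 :=
  chi_add_le_one fun hw hw' => hf.elim_of_two hw hw' hne ha ha'

/-- As `c s` can force, at most one of all the `L`, `R`, `Lk`, `Rk` is white. With a heavy slice `j`
the slices then total at most `2q + 1` and the bases at most 4, so the size hypothesis forces
equality everywhere, and the extremal configuration is `StuckL`. -/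
lemma CanForce.stuckL_of_slice {X Y : Finset (Vtx q)} {s : Fin q} {v : Vtx q}
    (hf : CanForce X Y (.c s) v) (h : Hole X Y) (hX : nA X ≤ 2) (hY : nA Y ≤ 2)
    (hXC : nC X = 0) (hYC : nC Y = 0) (hcard : 2 * q + 5 ≤ X.card + Y.card) {j : Fin q}
    (hj : 3 ≤ slice Y j) : StuckL X Y := by
  have p0 := hf.chi_add_chi_le (w := .L j) (w' := .R j) trivial trivial (by simp)
  have pLL := fun t ht => hf.chi_add_chi_le (w := .L t) (w' := .L j) trivial trivial ht
  have pLR := fun t => hf.chi_add_chi_le (w := .L t) (w' := .R j) trivial trivial (by simp)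
  have pRL := fun t => hf.chi_add_chi_le (w := .R t) (w' := .L j) trivial trivial (by simp)
  have pRR := fun t ht => hf.chi_add_chi_le (w := .R t) (w' := .R j) trivial trivial ht
  have p1 := hf.chi_add_chi_le (w := .Lk) (w' := .L j) trivial trivial (by simp)
  have p2 := hf.chi_add_chi_le (w := .Lk) (w' := .R j) trivial trivial (by simp)
  have p3 := hf.chi_add_chi_le (w := .Rk) (w' := .L j) trivial trivial (by simp)
  have p4 := hf.chi_add_chi_le (w := .Rk) (w' := .R j) trivial trivial (by simp)
  have yQ := chi_le_one Y (.Q j)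
  have yb := chi_le_one Y (.b j)
  rw [slice] at hj
  have xQ := fun t => h.chi_le (x := .Q t) (y := .b j) trivial
  have xb := fun t => h.chi_le (x := .b t) (y := .Q j) trivial
  have xb0 := h.chi_le (x := .b0) (y := .Q j) trivial
  have xLk := h.chi_le (x := .Lk) (y := .Q j) trivial
  have xbk := h.chi_le (x := .bk) (y := .R j) trivial
  have xRk := h.chi_le (x := .Rk) (y := .L j) trivial
  have xLj := h.chi_self_le (.L j)
  -- Each `R t` is adjacent to `L j` or to `Q j`, according to the order of `t` and `j`. Here `Q j`
  -- is white, since slice `j` lacks one of `L j`, `R j` and so contains the rest.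
  have hxR : chi Y (.L j) = 1 → ∀ t, chi X (.R t) = 0 := fun hL t => by
    rcases le_total j t with ht | ht
    · have := h.chi_le (x := .R t) (y := .L j) ht
      omega
    · have := h.chi_le (x := .R t) (y := .Q j) ht
      omega
  have hxL : chi Y (.R j) = 1 → ∀ t, chi X (.L t) = 0 := fun hR t => by
    rcases le_or_gt t j with ht | ht
    · have := h.chi_le (x := .L t) (y := .R j) ht
      omega
    · have := h.chi_le (x := .L t) (y := .Q j) ht
      omega
  have hxRj := h.chi_le (x := .R j) (y := .Q j) (le_refl j)
  have aX := h.sepA.nA_le_one (β := .b j) trivial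
  have a0 := h.sepA.nA_eq_zero
  have a1 := fun hY => h.reverse.sepA.chi_eq_zero hY (β := .bk) trivial
  have sk := h.chi_self_le .bk
  have s0 := h.chi_self_le .b0
  have sRk := h.chi_le (x := .Rk) (y := .b0) trivial
  have hb : base X + base Y ≤ 4 ∧ (4 ≤ base X + base Y → nA Y = 2 ∧ chi Y .bk = 1 ∧
      chi X .Rk + chi Y .b0 = 1) := by
    rw [base, base]
    omega
  have hs : ∀ t, slice X t + slice Y t ≤ 2 + if t = j then 1 else 0 := fun t => by
    have := pLR t
    have := pRL t
    have := xQ t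
    have := xb t
    have := fun h => hxR h t
    have := fun h => hxL h t
    rw [slice, slice]
    by_cases ht : t = j
    · subst ht
      rw [if_pos rfl]
      omega
    · have := pLL t (by simpa using ht)
      have := pRR t (by simpa using ht)
      have := h.chi_le (x := .L t) (y := .b t) rfl
      have := h.chi_le (x := .R t) (y := .Q t) (le_refl t)
      have := chi_le_one Y (.Q t)
      have := chi_le_one Y (.b t)
      rw [if_neg ht]
      omega
  have hsum : ∑ t : Fin q, (2 + if t = j then 1 else 0) = 2 * q + 1 := by
    simp [Finset.sum_add_distrib, mul_comm]
  have hle := Finset.sum_le_sum fun t (_ : t ∈ Finset.univ) => hs t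
  rw [card_eq X, card_eq Y] at hcard
  have hge : ∑ t, (slice X t + slice Y t) = 2 * q + 1 := by
    rw [hsum] at hle
    rw [Finset.sum_add_distrib] at hle ⊢
    omega
  have heq := (Finset.sum_eq_sum_iff_of_le fun t (_ : t ∈ Finset.univ) => hs t).1
    (hge.trans hsum.symm)
  rw [Finset.sum_add_distrib] at hge
  obtain ⟨b1, b2, b3⟩ := hb.2 (by omega)
  have key : ∀ t, chi Y (.Q t) = 1 ∧ chi X (.L t) + chi Y (.b t) = 1 := fun t => by
    have h1 := heq t (Finset.mem_univ t)
    have := pLR t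
    have := pRL t
    have := xQ t
    have := xb t
    have := fun h => hxR h t
    have := fun h => hxL h t
    have := h.chi_le (x := .L t) (y := .b t) rfl
    have := h.chi_le (x := .R t) (y := .bk) trivial
    have := chi_le_one Y (.Q t)
    have := chi_le_one Y (.b t)
    rw [slice, slice] at h1
    by_cases ht : t = j
    · subst ht
      rw [if_pos rfl] at h1
      omega
    · have := pLL t (by simpa using ht)
      have := pRR t (by simpa using ht)
      rw [if_neg ht] at h1
      omega
  refine ⟨fun t => chi_eq_one.1 (key t).1, chi_eq_one.1 b2, b1.ge, fun t => ?_, ?_⟩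
  · rw [← chi_eq_one, ← chi_eq_one]
    have := (key t).2
    omega
  · rw [← chi_eq_one, ← chi_eq_one]
    omega

/-- One of `Lk`, `Rk` must be the unique white neighbor of `c s`, so no `L t` or `R t` is white.
Bases total 5 and slices at most `2q`, and equality again yields `StuckL`. -/
lemma CanForce.stuckL_of_base {X Y : Finset (Vtx q)} {s : Fin q} {v : Vtx q}
    (hf : CanForce X Y (.c s) v) (h : Hole X Y) (hY : nA Y ≤ 2)
    (hXC : nC X = 0) (hYC : nC Y = 0) (hcard : 2 * q + 5 ≤ X.card + Y.card)
    (hb : 5 ≤ base Y) : StuckL X Y := by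
  have p := hf.chi_add_chi_le (w := .Lk) (w' := .Rk) trivial trivial (by simp)
  have yk := chi_le_one Y .bk
  have y0 := chi_le_one Y .b0
  rw [base] at hb
  obtain ⟨h2, hk, h0⟩ : nA Y = 2 ∧ chi Y .bk = 1 ∧ chi Y .b0 = 1 := by omega
  have hb' : base X + base Y = 5 := by
    have := h.sepA.nA_eq_zero
    have := h.chi_self_le .bk
    have := h.chi_self_le .b0
    have := h.chi_le (x := .Lk) (y := .bk) trivial
    have := h.chi_le (x := .Rk) (y := .b0) trivial
    rw [base, base]
    omega
  have hz : ∀ t, chi X (.Q t) = 0 ∧ chi X (.R t) = 0 ∧ chi X (.b t) = 0 ∧ chi Y (.L t) = 0 ∧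
      chi Y (.R t) = 0 ∧ chi X (.L t) + chi Y (.b t) ≤ 1 ∧ chi Y (.Q t) ≤ 1 := fun t => by
    have := h.chi_le (x := .Q t) (y := .b0) trivial
    have := h.chi_le (x := .R t) (y := .bk) trivial
    have := h.reverse.sepA.chi_eq_zero h2.ge (β := .b t) trivial
    have := hf.chi_add_chi_le (w := .Lk) (w' := .L t) trivial trivial (by simp)
    have := hf.chi_add_chi_le (w := .Lk) (w' := .R t) trivial trivial (by simp)
    have := hf.chi_add_chi_le (w := .Rk) (w' := .L t) trivial trivial (by simp)
    have := hf.chi_add_chi_le (w := .Rk) (w' := .R t) trivial trivial (by simp)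
    have := h.chi_le (x := .L t) (y := .b t) rfl
    have := chi_le_one Y (.Q t)
    omega
  have hs : ∀ t ∈ Finset.univ, slice X t + slice Y t ≤ 2 := fun t _ => by
    have := hz t
    rw [slice, slice]
    omega
  have hsum : ∑ t : Fin q, 2 = 2 * q := by simp [mul_comm]
  have hle := Finset.sum_le_sum hs
  rw [card_eq X, card_eq Y] at hcard
  have hge : ∑ t, (slice X t + slice Y t) = 2 * q := by
    rw [hsum] at hle
    rw [Finset.sum_add_distrib] at hle ⊢
    omega
  have heq := (Finset.sum_eq_sum_iff_of_le hs).1 (hge.trans hsum.symm)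
  have key : ∀ t, chi Y (.Q t) = 1 ∧ chi X (.L t) + chi Y (.b t) = 1 := fun t => by
    have h1 := heq t (Finset.mem_univ t)
    have := hz t
    rw [slice, slice] at h1
    omega
  refine ⟨fun t => chi_eq_one.1 (key t).1, chi_eq_one.1 hk, h2.ge, fun t => ?_,
    Or.inr (chi_eq_one.1 h0)⟩
  rw [← chi_eq_one, ← chi_eq_one]
  have := (key t).2
  omega

lemma CanForce.stuckL {X Y : Finset (Vtx q)} {s : Fin q} {v : Vtx q}
    (hf : CanForce X Y (.c s) v) (h : Hole X Y) (hX : nA X ≤ 2) (hY : nA Y ≤ 2)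
    (hXC : nC X = 0) (hYC : nC Y = 0) (hcard : 2 * q + 5 ≤ X.card + Y.card)
    (hH : Heavy Y) : StuckL X Y := by
  rcases hH with ⟨j, hj⟩ | hb
  · exact hf.stuckL_of_slice h hX hY hXC hYC hcard hj
  · exact hf.stuckL_of_base h hY hXC hYC hcard hb

/-- The total is within one of its maximum `2q + 4`, so the deficit, if any, sits in a single place.
-/
lemma eq_two_or_of_sum_ge {f : Fin q → ℕ} (hf : ∀ t, f t ≤ 2) {b : ℕ} (hb : b ≤ 4)
    (h : 2 * q + 3 ≤ ∑ t, f t + b) : (3 ≤ b ∧ ∀ t, f t = 2) ∨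
      (b = 4 ∧ ∃ t₀, f t₀ = 1 ∧ ∀ t, t ≠ t₀ → f t = 2) := by
  have hs : ∀ t ∈ Finset.univ, f t ≤ 2 := fun t _ => hf t
  have hsum : ∑ t : Fin q, 2 = 2 * q := by simp [mul_comm]
  by_cases hall : ∀ t, f t = 2
  · refine Or.inl ⟨?_, hall⟩
    have := Finset.sum_le_sum hs
    omega
  · push Not at hall
    obtain ⟨t₀, h₀⟩ := hall
    have hle : ∀ t ∈ Finset.univ, f t + (if t = t₀ then 1 else 0) ≤ 2 := fun t _ => by
      have := hf t
      split_ifs with e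
      · subst e; omega
      · omega
    have hle' := Finset.sum_le_sum hle
    have he : ∑ t, (f t + if t = t₀ then 1 else 0) = ∑ t, f t + 1 := by
      simp [Finset.sum_add_distrib]
    have heq := (Finset.sum_eq_sum_iff_of_le hle).1 (by omega)
    refine Or.inr ⟨by omega, t₀, ?_, fun t ht => ?_⟩
    · have := heq t₀ (Finset.mem_univ _)
      simpa using this
    · have := heq t (Finset.mem_univ _)
      simpa [ht] using this

lemma Hole.slice_eq_of_mem_c {X Y : Finset (Vtx q)} (h : Hole X Y) {s : Fin q} (hs : .c s ∈ Y)
    (t : Fin q) : slice X t = chi X (.Q t) + chi X (.b t) := by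
  have := h.chi_le (x := .L t) (y := .c s) trivial
  have := h.chi_le (x := .R t) (y := .c s) trivial
  have := chi_eq_one.2 hs
  rw [slice]
  omega

lemma Hole.base_eq_of_mem_c {X Y : Finset (Vtx q)} (h : Hole X Y) {s : Fin q} (hs : .c s ∈ Y) :
    base X = nA X + chi X .bk + chi X .b0 := by
  have := h.chi_le (x := .Lk) (y := .c s) trivial
  have := h.chi_le (x := .Rk) (y := .c s) trivial
  have := chi_eq_one.2 hs
  rw [base]
  omega

/-- With `C` met on both sides, only `A`, the `b_i` and the `Q t` can otherwise occur. When `X`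
contains no `b_i` except possibly `bk`, near-extremality also removes all `Q t` and `a_i` from `X`,
so `Y` contains almost everything. The value of `nA Y` decides between the two jams. -/
lemma Hole.stuckAll_or_stuckMost {X Y : Finset (Vtx q)} (hq : 0 < q) (h : Hole X Y)
    (hX : nA X ≤ 2) (hY : nA Y ≤ 2) {s s' : Fin q} (hsX : .c s' ∈ X) (hsY : .c s ∈ Y)
    (hcase : (3 ≤ base X + base Y ∧ ∀ t, slice X t + slice Y t = 2) ∨ (base X + base Y = 4 ∧
      ∃ t₀, slice X t₀ + slice Y t₀ = 1 ∧ ∀ t, t ≠ t₀ → slice X t + slice Y t = 2))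
    (hb : ∀ t, chi X (.b t) = 0) (hb0 : chi X .b0 = 0) : StuckAll X Y ∨ StuckMost X Y := by
  simp only [h.slice_eq_of_mem_c hsY, h.reverse.slice_eq_of_mem_c hsX, h.base_eq_of_mem_c hsY,
    h.reverse.base_eq_of_mem_c hsX, hb, hb0] at hcase
  have l := fun x => chi_le_one Y x
  have e := fun x => h.chi_self_le x
  have sk := h.chi_self_le .bk
  have a0 := h.sepA.nA_eq_zero
  have a1 := fun hY => h.reverse.sepA.chi_eq_zero hY (β := .bk) trivial
  have hQ : ∀ t, chi X (.Q t) = 0 := fun t => by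
    have h1 := h.chi_le (x := .Q t) (y := .b t) trivial
    have h2 := h.chi_le (x := .Q t) (y := .b0) trivial
    have h3 := e (.Q t)
    have l1 := l .b0
    have l2 := l (.b t)
    rcases hcase with ⟨-, hc⟩ | ⟨hc, -⟩
    · have := hc t
      omega
    · by_contra hne
      have a2 := fun hX => h.sepA.chi_eq_zero hX (β := .bk) trivial
      omega
  simp only [hQ] at hcase
  have hX0 : nA X = 0 := by
    by_contra hne
    have := fun hX => h.sepA.chi_eq_zero hX (β := .b ⟨0, hq⟩) trivial
    have := fun hX => h.sepA.chi_eq_zero hX (β := .b0) trivial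
    have := fun hX => h.sepA.chi_add_chi_le hX (β := .b ⟨0, hq⟩) (β' := .b0) trivial trivial
      (by simp)
    have l1 := l .b0
    have l2 := l (.b ⟨0, hq⟩)
    have l3 := l (.Q ⟨0, hq⟩)
    rcases hcase with ⟨hc, hc'⟩ | ⟨hc, -⟩
    · have := hc' ⟨0, hq⟩
      omega
    · omega
  rw [hX0] at hcase
  have l0 := l .b0
  by_cases h2 : 2 ≤ nA Y
  · right
    refine ⟨⟨s, hsY⟩, fun x y hx hy hxY hyY => ?_, h2⟩
    rw [← chi_eq_zero] at hxY hyY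
    have hk := a1 h2
    rcases hcase with ⟨hc, hc'⟩ | ⟨hc, t₀, h₀, hc'⟩
    · have hQb : ∀ t, chi Y (.Q t) = 1 ∧ chi Y (.b t) = 1 := fun t => by
        have := hc' t
        have := l (.Q t)
        have := l (.b t)
        omega
      cases x <;> cases y <;> simp only [Vtx.IsBQ] at hx hy <;> simp_all <;> omega
    · have hQb : ∀ t, t ≠ t₀ → chi Y (.Q t) = 1 ∧ chi Y (.b t) = 1 := fun t ht => by
        have := hc' t ht
        have := l (.Q t)
        have := l (.b t)
        omega
      have hx' : x = .Q t₀ ∨ x = .b t₀ := by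
        cases x with
        | Q t => left; by_contra ht; have := hQb t (by simpa using ht); omega
        | b t => right; by_contra ht; have := hQb t (by simpa using ht); omega
        | bk => omega
        | b0 => omega
        | _ => exact hx.elim
      have hy' : y = .Q t₀ ∨ y = .b t₀ := by
        cases y with
        | Q t => left; by_contra ht; have := hQb t (by simpa using ht); omega
        | b t => right; by_contra ht; have := hQb t (by simpa using ht); omega
        | bk => omega
        | b0 => omega
        | _ => exact hy.elim
      rcases hx' with rfl | rfl <;> rcases hy' with rfl | rfl <;> first | rfl | omega
  · left
    rcases hcase with ⟨hc, hc'⟩ | ⟨hc, -⟩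
    · have hQb : ∀ t, chi Y (.Q t) = 1 ∧ chi Y (.b t) = 1 := fun t => by
        have := hc' t
        have := l (.Q t)
        have := l (.b t)
        omega
      refine ⟨⟨s, hsY⟩, fun t => chi_eq_one.1 (hQb t).1, fun t => chi_eq_one.1 (hQb t).2,
        chi_eq_one.1 (by omega), ?_, by omega⟩
      rw [← chi_eq_one, ← chi_eq_one]
      omega
    · omega

/-- If one side has no `b t` and no `b0`, the state or its reverse is stuck. Otherwise each side has
such a vertex, which keeps every `Q t` and a second `a_i` out of the other side, and the counts are
too small. -/
lemma Live.false_of_nC_pos {X Y : Finset (Vtx q)} (hq : 0 < q) (hL : Live X Y)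
    (hcard : 2 * q + 5 ≤ X.card + Y.card) (hXC : 1 ≤ nC X) (hYC : 1 ≤ nC Y) : False := by
  have h := hL.hole
  have hX := hL.nA_left_le
  have hY := hL.nA_right_le
  have hXC' := hL.nC_left_le
  have hYC' := hL.nC_right_le
  obtain ⟨s', hsX⟩ := nC_pos hXC
  obtain ⟨s, hsY⟩ := nC_pos hYC
  have slX := h.slice_eq_of_mem_c hsY
  have slY := h.reverse.slice_eq_of_mem_c hsX
  have bX := h.base_eq_of_mem_c hsY
  have bY := h.reverse.base_eq_of_mem_c hsX
  have a0 := h.sepA.nA_eq_zero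
  have e0 := h.chi_self_le .b0
  have ek := h.chi_self_le .bk
  have hcase := eq_two_or_of_sum_ge (f := fun t => slice X t + slice Y t) (fun t => by
    have := h.chi_self_le (.Q t)
    have := h.chi_self_le (.b t)
    simp only [slX, slY]
    omega) (b := base X + base Y) (by omega) (by
      rw [card_eq X, card_eq Y] at hcard
      rw [Finset.sum_add_distrib]
      omega)
  by_cases h1 : (∀ t, chi X (.b t) = 0) ∧ chi X .b0 = 0
  · exact hL.not_stuckAll_or_stuckMost hq
      (h.stuckAll_or_stuckMost hq hX hY hsX hsY hcase h1.1 h1.2)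
  by_cases h2 : (∀ t, chi Y (.b t) = 0) ∧ chi Y .b0 = 0
  · exact hL.reverse.not_stuckAll_or_stuckMost hq
      (h.reverse.stuckAll_or_stuckMost hq hY hX hsY hsX
        (by simpa only [add_comm] using hcase) h2.1 h2.2)
  have hB : ∀ {Z : Finset (Vtx q)}, ¬((∀ t, chi Z (.b t) = 0) ∧ chi Z .b0 = 0) →
      ∃ β : Vtx q, β.IsB ∧ (∀ t, Vtx.Adj (.Q t) β) ∧ chi Z β = 1 := fun {Z} hZ => by
    rw [not_and_or, not_forall] at hZ
    rcases hZ with ⟨t, ht⟩ | h0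
    · exact ⟨.b t, trivial, fun _ => trivial, by have := chi_le_one Z (.b t); omega⟩
    · exact ⟨.b0, trivial, fun _ => trivial, by have := chi_le_one Z .b0; omega⟩
  obtain ⟨β, hβ, hQβ, hβX⟩ := hB h1
  obtain ⟨β', hβ', hQβ', hβY⟩ := hB h2
  have := h.chi_le (hQβ' ⟨0, hq⟩)
  have := h.reverse.chi_le (hQβ ⟨0, hq⟩)
  have := h.chi_self_le (.b ⟨0, hq⟩)
  have := h.sepA.nA_le_one hβ' hβY.ge
  have := h.reverse.sepA.nA_le_one hβ hβX.ge
  rcases hcase with ⟨-, hc⟩ | ⟨hc, -⟩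
  · have := hc ⟨0, hq⟩
    simp only [slX, slY] at this
    omega
  · omega

lemma Heavy.ne_empty {X : Finset (Vtx q)} (h : Heavy X) : X ≠ ∅ := by
  rintro rfl
  simp [Heavy, slice, base, chi, nA, aSet] at h

/-- An invariant of the states with many unused or white vertices. -/
def Early (X Y : Finset (Vtx q)) : Prop := nC X = 0 ∧ (nC Y = 1 ∨ nC Y = 0 ∧ Heavy Y)

lemma Hole.nearHole {X Y : Finset (Vtx q)} {u v : Vtx q} (h : Hole X Y)
    (hf : CanForce X Y u v) : NearHole (insert u X) Y u v := by
  intro x hx y hy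
  rcases Finset.mem_insert.1 hx with rfl | hx
  · exact ⟨fun e => hf.u_notMem_right (e ▸ hy), fun ha => ⟨rfl, hf.eq_of_adj y hy ha⟩⟩
  · exact ⟨(h x hx y hy).1, fun ha => ((h x hx y hy).2 ha).elim⟩

lemma Early.step {X Y : Finset (Vtx q)} {u v : Vtx q} (hq : 0 < q) (hE : Early X Y)
    (hL : Live X Y) (hL' : Live (insert u X) (Y.erase v)) (hf : CanForce X Y u v)
    (hcard : 2 * q + 5 ≤ X.card + Y.card) : Early (insert u X) (Y.erase v) := by
  have c1 := Finset.card_insert_of_notMem hf.u_notMem_left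
  have c2 := Finset.card_erase_add_one hf.v_mem_right
  by_cases hu : ∀ i, u ≠ .c i
  · have hX := (nC_insert (X := X) hu).trans hE.1
    refine ⟨hX, ?_⟩
    have light : ∀ h0 : nC (Y.erase v) = 0, ¬ Heavy (Y.erase v) → Heavy (insert u X) :=
      fun h0 hY => by
        by_contra hX'
        have := hL'.hole.card_add_card_le hL'.nA_left_le hL'.nA_right_le hX h0 hX' hY
        omega
    rcases hE.2 with h1 | ⟨h0, hH⟩
    · by_cases hv : ∀ i, v ≠ .c i
      · exact Or.inl ((nC_erase hv).trans h1)
      · push Not at hv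
        obtain ⟨t, rfl⟩ := hv
        have h0 : nC (Y.erase (.c t)) = 0 := by
          have : cSet (Y.erase (.c t)) = (cSet Y).erase t := by ext; simp [cSet]
          rw [nC, this, Finset.card_erase_of_mem (by simpa [cSet] using hf.v_mem_right)]
          rw [nC] at h1
          omega
        refine Or.inr ⟨h0, by_contra fun hY => hL'.reverse.not_stuckL hq ?_⟩
        -- Backwards in time, the vertex of `C` just forced is the forcer, and the heavy set `insert
        -- u X` plays the role of the white set.
        exact hf.reverse.stuckL hL'.hole.reverse hL'.nA_right_le hL'.nA_left_le h0 hX (by omega)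
          (light h0 hY)
    · have h0' : nC (Y.erase v) = 0 := by
        refine (nC_erase ?_).trans h0
        rintro i rfl
        have := nC_pos_of_mem hf.v_mem_right
        omega
      refine Or.inr ⟨h0', by_contra fun hY => ?_⟩
      -- Midway through the force, `insert u X` and `Y` have total size at least `2q + 6`, one more
      -- than two heavy sides allow.
      have := (hL.hole.nearHole hf).card_add_card_le hL'.nA_left_le hL.nA_right_le hX h0
        (light h0' hY) hH
      omega
  · exfalso
    push Not at hu
    obtain ⟨t, rfl⟩ := hu
    rcases hE.2 with h1 | ⟨h0, hH⟩
    · refine hL'.false_of_nC_pos hq (by omega) (nC_pos_of_mem (i := t) (by simp)) ?_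
      rw [nC_erase, h1]
      rintro i rfl
      exact hf.adj
    · exact hL.not_stuckL hq (hf.stuckL hL.hole hL.nA_left_le hL.nA_right_le hE.1 h0 hcard hH)

lemma card_le_of_reflTransGen (hq : 0 < q) {W U : Finset (Vtx q)}
    (h : Relation.ReflTransGen Step (∅, W) (U, ∅)) : W.card ≤ 2 * q + 4 := by
  by_contra hW
  suffices H : ∀ s : Finset (Vtx q) × Finset (Vtx q), Relation.ReflTransGen Step (∅, W) s →
      Relation.ReflTransGen Step s (U, ∅) → Early s.1 s.2 ∧ s.1.card + s.2.card = W.card by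
    obtain ⟨⟨-, h | ⟨-, h⟩⟩, -⟩ := H _ h .refl
    · simp [nC, cSet] at h
    · exact h.ne_empty rfl
  intro s hs
  induction hs with
  | refl =>
    intro _
    have hL : Live ∅ W := ⟨⟨W, .refl⟩, U, h⟩
    have hC : nC (∅ : Finset (Vtx q)) = 0 := by simp [nC, cSet]
    refine ⟨⟨hC, ?_⟩, by simp⟩
    by_contra hn
    have h1 : nC W ≠ 1 := fun h => hn (Or.inl h)
    have := hL.nC_right_le
    have h0 : nC W = 0 := by omega
    have := hL.hole.card_add_card_le hL.nA_left_le hL.nA_right_le hC h0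
      (fun h => h.ne_empty rfl) (fun h => hn (Or.inr ⟨h0, h⟩))
    simp at this
    omega
  | @tail s s' hs hstep ih =>
    intro hs'
    obtain ⟨hE, hc⟩ := ih (.head hstep hs')
    have hL : Live s.1 s.2 := ⟨⟨W, hs⟩, U, .head hstep hs'⟩
    have hL' : Live s'.1 s'.2 := ⟨⟨W, hs.tail hstep⟩, U, hs'⟩
    obtain ⟨u, v, hf, rfl⟩ := hstep
    refine ⟨hE.step hq hL hL' hf (by omega), ?_⟩
    have c1 := Finset.card_insert_of_notMem hf.u_notMem_left
    have c2 := Finset.card_erase_add_one hf.v_mem_right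
    simp only
    omega

/-- The labels of the vertices outside of a set. -/
def white (B : Finset (Vertex (q + 1))) : Finset (Vtx q) :=
  Finset.univ.filter fun v => v.toVertex ∉ B

lemma mem_white {B : Finset (Vertex (q + 1))} {v : Vtx q} : v ∈ white B ↔ v.toVertex ∉ B := by
  simp [white]

/-- Carrying `Hole` through the induction shows that no vertex forces twice: a vertex that has
forced has no white neighbor left. -/
lemma exists_reflTransGen_step {S B : Finset (Vertex (q + 1))}
    (h : Relation.ReflTransGen (ForceStep (graphG (q + 1))) S B) :
    ∃ X, Relation.ReflTransGen Step (∅, white S) (X, white B) ∧ Hole X (white B) := by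
  induction h with
  | refl => exact ⟨∅, .refl, fun x hx => by simp at hx⟩
  | @tail B B' _ hstep ih =>
    obtain ⟨X, hX, hole⟩ := ih
    obtain ⟨u, hu, v, hv, ha, huniq, rfl⟩ := hstep
    obtain ⟨u, rfl⟩ := (Vtx.equivVertex q).surjective u
    obtain ⟨v, rfl⟩ := (Vtx.equivVertex q).surjective v
    change Vtx.toVertex u ∈ B at hu
    change Vtx.toVertex v ∉ B at hv
    have hadj : Vtx.Adj u v := (graphG_adj_iff u v).1 ha
    have hvw := mem_white.2 hv
    have hf : CanForce X (white B) u v :=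
      { u_notMem_left := fun hm => (hole u hm v hvw).2 hadj
        u_notMem_right := fun hm => mem_white.1 hm hu
        v_notMem_left := fun hm => (hole v hm v hvw).1 rfl
        v_mem_right := hvw
        adj := hadj
        eq_of_adj := fun w hw haw => (Vtx.equivVertex q).injective
          (huniq _ ((graphG_adj_iff u w).2 haw) (mem_white.1 hw))
        not_adj := fun x hx hax => (hole x hx v hvw).2 hax.symm }
    have hW : white (insert (Vtx.equivVertex q v) B) = (white B).erase v := by
      ext w
      have : Vtx.toVertex w = Vtx.equivVertex q v ↔ w = v := (Vtx.equivVertex q).apply_eq_iff_eq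
      simp [mem_white, this]
    rw [hW]
    exact ⟨insert u X, hX.tail ⟨u, v, hf, rfl⟩, hole.step hf⟩

lemma card_vertex (q : ℕ) : Fintype.card (Vertex (q + 1)) = 6 * (q + 1) := by
  simp [Vertex]
  omega

lemma le_zeroForcingNumber_graphG (hq : 0 < q) :
    4 * (q + 1) - 2 ≤ zeroForcingNumber (graphG (q + 1)) := by
  refine le_csInf ⟨_, Finset.univ, .refl, rfl⟩ ?_
  rintro _ ⟨S, hS, rfl⟩
  obtain ⟨X, hX, -⟩ := exists_reflTransGen_step hS
  have h0 : white (Finset.univ : Finset (Vertex (q + 1))) = ∅ := by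
    ext; simp [mem_white]
  rw [h0] at hX
  have hle := card_le_of_reflTransGen hq hX
  have hc : Sᶜ.card ≤ (white S).card := by
    rw [← Finset.card_map (s := white S) (Vtx.equivVertex q).toEmbedding]
    refine Finset.card_le_card fun w hw => ?_
    obtain ⟨w, rfl⟩ := (Vtx.equivVertex q).surjective w
    exact Finset.mem_map_of_mem _ (mem_white.2 (Finset.mem_compl.1 hw))
  rw [Finset.card_compl, card_vertex] at hc
  omega

end Invariant

end RegularCospectral

theorem theorem5p2 (k : ℕ) (hk : 2 ≤ k) :
    Fintype.card (RegularCospectral.Vertex k) = 6 * k ∧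
    RegularCospectral.IsSwitchingSet (RegularCospectral.graphG k)
      (RegularCospectral.switchSet k) ∧
    (RegularCospectral.graphG k).IsRegularOfDegree (2 * k) ∧
    (RegularCospectral.graphG' k).IsRegularOfDegree (2 * k) ∧
    RegularCospectral.eigenvalueMultiset ((RegularCospectral.graphG k).adjMatrix ℝ) =
      RegularCospectral.eigenvalueMultiset ((RegularCospectral.graphG' k).adjMatrix ℝ) ∧
    RegularCospectral.eigenvalueMultiset ((RegularCospectral.graphG k).lapMatrix ℝ) =
      RegularCospectral.eigenvalueMultiset ((RegularCospectral.graphG' k).lapMatrix ℝ) ∧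
    RegularCospectral.eigenvalueMultiset
        (RegularCospectral.signlessLapMatrix (RegularCospectral.graphG k)) =
      RegularCospectral.eigenvalueMultiset
        (RegularCospectral.signlessLapMatrix (RegularCospectral.graphG' k)) ∧
    RegularCospectral.eigenvalueMultiset
        (RegularCospectral.normalizedLapMatrix (RegularCospectral.graphG k)) =
      RegularCospectral.eigenvalueMultiset
        (RegularCospectral.normalizedLapMatrix (RegularCospectral.graphG' k)) ∧
    RegularCospectral.zeroForcingNumber (RegularCospectral.graphG k) = 4 * k - 2 ∧
    RegularCospectral.zeroForcingNumber (RegularCospectral.graphG' k) ≤ 4 * k - 3 ∧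
    RegularCospectral.zeroForcingNumber (RegularCospectral.graphG k) ≠
      RegularCospectral.zeroForcingNumber (RegularCospectral.graphG' k) := by
  obtain ⟨q, rfl⟩ : ∃ q, k = q + 1 := ⟨k - 1, by omega⟩
  have hq : 0 < q := by omega
  obtain ⟨hadj, hlap, hsign, hnorm⟩ := RegularCospectral.cospectral_gmSwitch
    (RegularCospectral.graphG (q + 1)) (RegularCospectral.switchSet (q + 1))
    RegularCospectral.isSwitchingSet RegularCospectral.graphG_isRegularOfDegree
    RegularCospectral.graphG'_isRegularOfDegree
  have hZ : RegularCospectral.zeroForcingNumber (RegularCospectral.graphG (q + 1)) =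
      4 * (q + 1) - 2 :=
    le_antisymm RegularCospectral.zeroForcingNumber_graphG_le
      (RegularCospectral.le_zeroForcingNumber_graphG hq)
  have hZ' := RegularCospectral.zeroForcingNumber_graphG'_le hq
  exact ⟨RegularCospectral.card_vertex q, RegularCospectral.isSwitchingSet,
    RegularCospectral.graphG_isRegularOfDegree, RegularCospectral.graphG'_isRegularOfDegree,
    hadj, hlap, hsign, hnorm, hZ, hZ', by omega⟩
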